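/- Let $\lambda_{j,1}\neq\lambda_{j,2}$ ($j=1,2,3$) and $c$ be complex numbers with $\lambda_{1,1}\lambda_{1,2}\,\lambda_{2,1}\lambda_{2,2}\,\lambda_{3,1}\lambda_{3,2}\,c^2=1$ (in particular all are non-zero). Let $C_1,C_2,C_3\subset GL(4,\mathbf C)$ be the conjugacy classes of the diagonalizable matrices with eigenvalues $\lambda_{j,1},\lambda_{j,2}$, each of multiplicity $2$, and let $C_4\subset GL(4,\mathbf C)$ be the conjugacy class with the single eigenvalue $c$ and Jordan blocks of sizes $2,1,1$. For $j=1,\dots,4$ let $\sigma_{1,j},\dots,\sigma_{4,j}$ be the eigenvalues of $C_j$ repeated with their multiplicities. Assume that the eigenvalues are relatively generic, i.e. whenever $\Phi_1,\dots,\Phi_4\subset\{1,2,3,4\}$ have one and the same cardinality $m$, $0<m<4$, and $\prod_{j=1}^4\prod_{k\in\Phi_j}\sigma_{k,j}=1$, then for every $j$ the set $\Phi_j$ contains every eigenvalue of $C_j$ with exactly one half of its multiplicity (so that the relation is the displayed one). Let $$\mathcal V=\{(M_1,M_2,M_3,M_4)\ :\ M_j\in C_j,\ M_1M_2M_3M_4=I\},$$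 and let $\mathcal W\subset\mathcal V$ be the set of those quadruples for which there are an irreducible quadruple (one without a common invariant line) of matrices $N_j\in GL(2,\mathbf C)$ with $N_1N_2N_3N_4=I$, where $N_j$ is diagonalizable with eigenvalues $\lambda_{j,1},\lambda_{j,2}$ for $j=1,2,3$ and $N_4=cI$, and matrices $R_j\in gl(2,\mathbf C)$ and $G\in GL(4,\mathbf C)$, such that $$M_j=G\begin{pmatrix}N_j&R_j\\0&N_j\end{pmatrix}G^{-1}\qquad(j=1,2,3,4).$$ Then $\mathcal W$, as a subset of the affine space $\mathbf C^{64}$ of quadruples of $4\times4$ matrices, is an irreducible smooth variety of dimension $15$: it is locally closed and irreducible (in particular non-empty) in the Zariski topology, its dimension is $15$, and its Zariski tangent space at every point has dimension $15$. -/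

import Mathlib

namespace DeligneSimpson

open MvPolynomial

/-! ### Quasi-affine varieties over the complex numbers -/

section Varieties

variable {σ : Type*}

/-- The Zariski topology on the affine space `ℂ^σ` of closed points: the subspace topology for the
inclusion of the closed points in the prime spectrum of `ℂ[x_i | i ∈ σ]`. -/
@[reducible] noncomputable def zariski (σ : Type*) : TopologicalSpace (σ → ℂ) :=
  TopologicalSpace.induced (pointToPoint (k := ℂ)) inferInstance

/-- The Zariski-closed sets are the sets of common zeros of ideals of polynomials. -/
theorem isClosed_zariski_iff (X : Set (σ → ℂ)) :
    @IsClosed _ (zariski σ) X ↔ ∃ I : Ideal (MvPolynomial σ ℂ), X = zeroLocus ℂ I := by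
  have key : ∀ I : Ideal (MvPolynomial σ ℂ),
      (pointToPoint (k := ℂ) ⁻¹' PrimeSpectrum.zeroLocus (I : Set (MvPolynomial σ ℂ)) :
        Set (σ → ℂ)) = zeroLocus ℂ I := by
    intro I
    ext x
    constructor
    · intro h p hp
      exact (mem_vanishingIdeal_singleton_iff x p).1 (h hp)
    · intro h p hp
      exact (mem_vanishingIdeal_singleton_iff x p).2 (h p hp)
  unfold zariski
  rw [isClosed_induced_iff]
  constructor
  · rintro ⟨t, ht, rfl⟩
    obtain ⟨I, rfl⟩ := (PrimeSpectrum.isClosed_iff_zeroLocus_ideal t).1 ht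
    exact ⟨I, key I⟩
  · rintro ⟨I, rfl⟩
    exact ⟨_, PrimeSpectrum.isClosed_zeroLocus _, key I⟩

/-- The Zariski tangent space at `x` of the reduced variety `X` in the affine space `ℂ^σ`: the
vectors `v` that are annihilated by the differentials at `x` of all polynomials vanishing on
`X`. -/
def tangentSpace [Fintype σ] (X : Set (σ → ℂ)) (x : σ → ℂ) : Submodule ℂ (σ → ℂ) where
  carrier := {v | ∀ f ∈ vanishingIdeal ℂ X, ∑ i, eval x (pderiv i f) * v i = 0}
  zero_mem' := by
    intro f _
    simp
  add_mem' := by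
    intro v w hv hw f hf
    simp only [Pi.add_apply, mul_add, Finset.sum_add_distrib, hv f hf, hw f hf, add_zero]
  smul_mem' := by
    intro a v hv f hf
    have h : ∀ i, eval x (pderiv i f) * (a • v) i = a * (eval x (pderiv i f) * v i) := by
      intro i
      simp only [Pi.smul_apply, smul_eq_mul]
      ring
    simp only [h, ← Finset.mul_sum, hv f hf, mul_zero]

/-- `X` is an irreducible smooth (quasi-affine) variety of dimension `d`: it is Zariski-locally
closed in `ℂ^σ`, irreducible (in particular non-empty), of dimension `d` (the supremum of the
lengths of the chains of irreducible closed subsets), and at each of its points the Zariski tangent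
space has dimension `d`. -/
structure IsIrreducibleSmoothVariety [Fintype σ] (X : Set (σ → ℂ)) (d : ℕ) : Prop where
  locallyClosed : @IsLocallyClosed _ (zariski σ) X
  irreducible : @IsIrreducible _ (zariski σ) X
  dim_eq : @topologicalKrullDim X (TopologicalSpace.induced Subtype.val (zariski σ)) = d
  smooth : ∀ x ∈ X, Module.finrank ℂ (tangentSpace X x) = d

end Varieties

/-! ### Quadruples of matrices -/

/-- Complex `2 × 2` matrices. -/
abbrev Mat2 : Type := Matrix (Fin 2) (Fin 2) ℂ

/-- Complex `4 × 4` matrices; rows and columns are indexed by `Fin 2 ⊕ Fin 2`, so that a matrix is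
cut into blocks of size two. -/
abbrev Mat4 : Type := Matrix (Fin 2 ⊕ Fin 2) (Fin 2 ⊕ Fin 2) ℂ

/-- The 64 matrix entries of a quadruple of `4 × 4` matrices, as a point of affine space. -/
def coords (M : Fin 4 → Mat4) : Fin 4 × (Fin 2 ⊕ Fin 2) × (Fin 2 ⊕ Fin 2) → ℂ :=
  fun i => M i.1 i.2.1 i.2.2

/-- Eigenvalues, repeated with their multiplicities, of the four conjugacy classes: the `j`-th one
of the first three has the eigenvalues `lam j 0` and `lam j 1`, each of multiplicity two; the last
one has the single eigenvalue `c`, of multiplicity four. -/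
def eigenvalues (lam : Fin 3 → Fin 2 → ℂ) (c : ℂ) : Fin 4 → Fin 2 ⊕ Fin 2 → ℂ :=
  ![Sum.elim (lam 0) (lam 0), Sum.elim (lam 1) (lam 1), Sum.elim (lam 2) (lam 2), fun _ => c]

/-- The sets `Φ j` of indices, of one and the same cardinality strictly between zero and four,
define a non-genericity relation for the eigenvalues `e`. -/
def IsNonGenericityRelation (e : Fin 4 → Fin 2 ⊕ Fin 2 → ℂ)
    (Φ : Fin 4 → Finset (Fin 2 ⊕ Fin 2)) : Prop :=
  (∃ m : ℕ, 0 < m ∧ m < 4 ∧ ∀ j, (Φ j).card = m) ∧ ∏ j, ∏ k ∈ Φ j, e j k = 1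

/-- The sets `Φ j` contain every eigenvalue with one half of its multiplicity. -/
def IsHalving (e : Fin 4 → Fin 2 ⊕ Fin 2 → ℂ) (Φ : Fin 4 → Finset (Fin 2 ⊕ Fin 2)) : Prop :=
  ∀ (j : Fin 4) (z : ℂ),
    2 * {k : Fin 2 ⊕ Fin 2 | k ∈ Φ j ∧ e j k = z}.ncard = {k : Fin 2 ⊕ Fin 2 | e j k = z}.ncard

/-- The eigenvalues (whose multiplicities have greatest common divisor two) are relatively generic
but not generic: the product of all eigenvalues with halved multiplicities is one (the basic
non-genericity relation), and every non-genericity relation is the basic one. (A consequence of the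
basic relation would have multiplicities that are an integer multiple of those of the basic one,
and only the basic one itself has less than four indices.) -/
structure IsRelativelyGenericNotGeneric (lam : Fin 3 → Fin 2 → ℂ) (c : ℂ) : Prop where
  basic : (∏ j, lam j 0 * lam j 1) * c ^ 2 = 1
  only_basic : ∀ Φ, IsNonGenericityRelation (eigenvalues lam c) Φ → IsHalving (eigenvalues lam c) Φ

/-- Jordan normal forms of the four classes: `diag (a, b, a, b)` for the first three; for the last
one, one Jordan block of size two and two of size one, all with the eigenvalue `c`. -/
noncomputable def jordanForm (lam : Fin 3 → Fin 2 → ℂ) (c : ℂ) : Fin 4 → Mat4 :=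
  ![Matrix.diagonal (Sum.elim (lam 0) (lam 0)), Matrix.diagonal (Sum.elim (lam 1) (lam 1)),
    Matrix.diagonal (Sum.elim (lam 2) (lam 2)),
    c • (1 : Mat4) + Matrix.single (Sum.inl 0) (Sum.inl 1) 1]

/-- The variety `𝒱` of the quadruples `(M₁, M₂, M₃, M₄)`, each `M_j` in its conjugacy class, with
`M₁ M₂ M₃ M₄ = I`. (`IsConj` is conjugacy by invertible matrices.) -/
def varietyV (lam : Fin 3 → Fin 2 → ℂ) (c : ℂ) : Set (Fin 4 → Mat4) :=
  {M | (∀ j, IsConj (jordanForm lam c j) (M j)) ∧ M 0 * M 1 * M 2 * M 3 = 1}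

/-- A quadruple of `2 × 2` matrices is irreducible: no common invariant line. -/
def IsIrreducibleQuadruple (N : Fin 4 → Mat2) : Prop :=
  ∀ p : Submodule ℂ (Fin 2 → ℂ), (∀ j, ∀ v ∈ p, (N j).mulVec v ∈ p) → p = ⊥ ∨ p = ⊤

/-- The irreducible quadruples of matrices `N_j ∈ GL(2, ℂ)` with product `I`, where `N₁`, `N₂`, `N₃`
are diagonalizable with eigenvalues `lam j 0`, `lam j 1`, and `N₄` is the scalar matrix `c`. -/
def quadruplesN (lam : Fin 3 → Fin 2 → ℂ) (c : ℂ) : Set (Fin 4 → Mat2) :=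
  {N | (∀ j : Fin 3, IsConj (Matrix.diagonal (lam j)) (N j.castSucc)) ∧ N 3 = c • (1 : Mat2) ∧
    N 0 * N 1 * N 2 * N 3 = 1 ∧ IsIrreducibleQuadruple N}

/-- The stratum `𝒲` of `𝒱`: the quadruples that are simultaneously conjugate to a quadruple of block
matrices `(N_j, R_j; 0, N_j)` with `N` as above. -/
def stratumW (lam : Fin 3 → Fin 2 → ℂ) (c : ℂ) : Set (Fin 4 → Mat4) :=
  {M | M ∈ varietyV lam c ∧ ∃ N ∈ quadruplesN lam c, ∃ (R : Fin 4 → Mat2) (g : Mat4ˣ),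
    ∀ j, M j = (g : Mat4) * Matrix.fromBlocks (N j) (R j) 0 (N j) * ((g⁻¹ : Mat4ˣ) : Mat4)}

end DeligneSimpson

/-! A block matrix (N, R; 0, N) is the matrix N + εR over the dual numbers ℂ[ε], embedded in gl(4)
by the algebra homomorphism `blockHom`. In these terms `mem_stratumW_iff` says that 𝒲 consists of
the GL(4)-conjugates of quadruples A over ℂ[ε] with product 1 in which A 0, A 1, A 2 have the
prescribed constant traces and determinants and A 3 = c + εn, with n a non-zero nilpotent matrix.

The 2 × 2 problem for N is rigid: relative genericity rules out a common eigenvector, and in a basis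
u, A 1 u, with u an eigenvector of A 0, the first matrix is triangular, the second is a companion
matrix, the single free entry is fixed by the trace of A 2, and A 2 itself by the product relation.
This argument works over ℂ[ε], so n is the only modulus left (`isDualQuadruple_normalFamily`,
`IsDualQuadruple.exists_conj_eq_normalFamily`). Since the nilpotents n ≠ 0 form one GL(2)-orbit, 𝒲
is the image of an open subset of ℂ^20 under a regular map, whence its irreducibility.

Conjugation by diag(s, 1) amounts to ε ↦ sε, so only the line through n counts, a point of a
projective line. The matrices commuting with a quadruple are the blocks (x, y; 0, x) with scalar x,
y. This predicts the dimension 16 − 2 + 1 = 15.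

Smoothness comes from explicit charts (`exists_chart`). Near a given point n is normalised to `nilp
t`, and the conjugating matrix is normalised by prescribing two entries of its inverse. For the
inverse map, the reductions of a quadruple modulo ε generate all 2 × 2 matrices and do not depend on
n, so fixed noncommutative polynomials produce the matrix units modulo ε. Combined with M 3 − c,
they give the slope t, exact matrix units, and a basis (`frame`), all rational in the entries of M.
Finally `isIrreducibleSmoothVariety_of_charts` deduces local closedness, dimension and tangent
spaces from such charts. -/

namespace DeligneSimpson

open MvPolynomial

/-! ### Regular functions -/

section Regular

variable {σ ι κ : Type*}

/-- The affine space `ℂ^σ`, carrying the Zariski topology. -/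
def Aff (σ : Type*) : Type _ := σ → ℂ

noncomputable instance (σ : Type*) : TopologicalSpace (Aff σ) := zariski σ

theorem isClosed_aff_iff {Z : Set (Aff σ)} : IsClosed Z ↔
    ∃ S : Set (MvPolynomial σ ℂ), ∀ x : σ → ℂ, x ∈ Z ↔ ∀ p ∈ S, eval x p = 0 := by
  refine (isClosed_zariski_iff Z).trans ⟨?_, ?_⟩
  · rintro ⟨I, rfl⟩
    exact ⟨I, fun x => Iff.rfl⟩
  · rintro ⟨S, hS⟩
    refine ⟨Ideal.span S, Set.ext fun x => (hS x).trans ?_⟩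
    rw [zeroLocus_span]
    rfl

theorem isOpen_basic (f : MvPolynomial σ ℂ) :
    IsOpen ({y | eval y f ≠ 0} : Set (Aff σ)) := by
  have h : IsClosed ({y | eval y f = 0} : Set (Aff σ)) :=
    isClosed_aff_iff.2 ⟨{f}, fun x => by simp; rfl⟩
  exact h.isOpen_compl

theorem isOpen_iff_basic {U : Set (Aff σ)} :
    IsOpen U ↔ ∀ x ∈ U, ∃ f : MvPolynomial σ ℂ, eval x f ≠ 0 ∧ ∀ y, eval y f ≠ 0 → y ∈ U := by
  constructor
  · intro hU x hx
    obtain ⟨S, hS⟩ := isClosed_aff_iff.1 hU.isClosed_compl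
    have : ¬ ∀ p ∈ S, eval (x : σ → ℂ) p = 0 := fun h => (hS x).2 h hx
    push Not at this
    obtain ⟨f, hf, hfx⟩ := this
    exact ⟨f, hfx, fun y hy => by_contra fun hyU => hy ((hS y).1 hyU f hf)⟩
  · intro h
    refine isOpen_iff_forall_mem_open.2 fun x hx => ?_
    obtain ⟨f, hf, hU⟩ := h x hx
    exact ⟨_, fun y hy => hU y hy, isOpen_basic f, hf⟩

/-- `F` agrees with a quotient of polynomials in a Zariski neighbourhood of `x`. -/
def RegAt (F : (σ → ℂ) → ℂ) (x : σ → ℂ) : Prop :=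
  ∃ P Q : MvPolynomial σ ℂ, eval x Q ≠ 0 ∧ ∀ y, eval y Q ≠ 0 → F y = eval y P / eval y Q

theorem RegAt.const (c : ℂ) (x : σ → ℂ) : RegAt (fun _ => c) x :=
  ⟨C c, 1, by simp, by simp⟩

theorem RegAt.coord (i : σ) (x : σ → ℂ) : RegAt (fun y => y i) x :=
  ⟨X i, 1, by simp, by simp⟩

theorem RegAt.add {F G : (σ → ℂ) → ℂ} {x : σ → ℂ} (hF : RegAt F x) (hG : RegAt G x) :
    RegAt (fun y => F y + G y) x := by
  obtain ⟨P, Q, hQ, h⟩ := hF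
  obtain ⟨P', Q', hQ', h'⟩ := hG
  refine ⟨P * Q' + Q * P', Q * Q', by simp [hQ, hQ'], fun y hy => ?_⟩
  simp only [map_mul, mul_ne_zero_iff] at hy
  beta_reduce
  rw [h y hy.1, h' y hy.2, div_add_div _ _ hy.1 hy.2]
  simp

theorem RegAt.mul {F G : (σ → ℂ) → ℂ} {x : σ → ℂ} (hF : RegAt F x) (hG : RegAt G x) :
    RegAt (fun y => F y * G y) x := by
  obtain ⟨P, Q, hQ, h⟩ := hF
  obtain ⟨P', Q', hQ', h'⟩ := hG
  refine ⟨P * P', Q * Q', by simp [hQ, hQ'], fun y hy => ?_⟩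
  simp only [map_mul, mul_ne_zero_iff] at hy
  beta_reduce
  rw [h y hy.1, h' y hy.2, div_mul_div_comm]
  simp

theorem RegAt.inv {F : (σ → ℂ) → ℂ} {x : σ → ℂ} (hF : RegAt F x) (h0 : F x ≠ 0) :
    RegAt (fun y => (F y)⁻¹) x := by
  obtain ⟨P, Q, hQ, h⟩ := hF
  have hP : MvPolynomial.eval x P ≠ 0 := by
    intro hP
    exact h0 (by rw [h x hQ, hP, zero_div])
  refine ⟨Q * Q, P * Q, by simp [hQ, hP], fun y hy => ?_⟩
  simp only [map_mul, mul_ne_zero_iff] at hy ⊢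
  rw [h y hy.2, inv_div]
  have := hy.1
  have := hy.2
  field_simp

theorem RegAt.div {F G : (σ → ℂ) → ℂ} {x : σ → ℂ} (hF : RegAt F x) (hG : RegAt G x)
    (h0 : G x ≠ 0) : RegAt (fun y => F y / G y) x := by
  simpa only [div_eq_mul_inv] using hF.mul (hG.inv h0)

theorem RegAt.neg {F : (σ → ℂ) → ℂ} {x : σ → ℂ} (hF : RegAt F x) :
    RegAt (fun y => - F y) x := by
  simpa using (RegAt.const (-1) x).mul hF

theorem RegAt.sub {F G : (σ → ℂ) → ℂ} {x : σ → ℂ} (hF : RegAt F x) (hG : RegAt G x) :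
    RegAt (fun y => F y - G y) x := by
  simpa only [sub_eq_add_neg] using hF.add hG.neg

theorem RegAt.sum {α : Type*} (s : Finset α) {F : α → (σ → ℂ) → ℂ} {x : σ → ℂ}
    (hF : ∀ a ∈ s, RegAt (F a) x) : RegAt (fun y => ∑ a ∈ s, F a y) x := by
  classical
  induction s using Finset.induction_on with
  | empty => simpa using RegAt.const 0 x
  | insert a s ha ih =>
    simp only [Finset.sum_insert ha]
    exact (hF a (by simp)).add (ih fun b hb => hF b (by simp [hb]))

theorem RegAt.prod {α : Type*} (s : Finset α) {F : α → (σ → ℂ) → ℂ} {x : σ → ℂ}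
    (hF : ∀ a ∈ s, RegAt (F a) x) : RegAt (fun y => ∏ a ∈ s, F a y) x := by
  classical
  induction s using Finset.induction_on with
  | empty => simpa using RegAt.const 1 x
  | insert a s ha ih =>
    simp only [Finset.prod_insert ha]
    exact (hF a (by simp)).mul (ih fun b hb => hF b (by simp [hb]))

/-- Regularity at `x` only depends on the values in a Zariski neighbourhood of `x`. -/
theorem RegAt.congr_of_ne {F G H : (σ → ℂ) → ℂ} {x : σ → ℂ} (hF : RegAt F x) (hH : RegAt H x)
    (h0 : H x ≠ 0) (h : ∀ y, H y ≠ 0 → G y = F y) : RegAt G x := by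
  obtain ⟨P, Q, hQ, hPQ⟩ := hF
  obtain ⟨P', Q', hQ', hPQ'⟩ := hH
  have hP' : MvPolynomial.eval x P' ≠ 0 := by
    intro hP
    exact h0 (by rw [hPQ' x hQ', hP, zero_div])
  refine ⟨P * (P' * Q'), Q * (P' * Q'), by simp [hQ, hQ', hP'], fun y hy => ?_⟩
  simp only [map_mul, mul_ne_zero_iff] at hy ⊢
  obtain ⟨h1, h2, h3⟩ := hy
  rw [h y (by rw [hPQ' y h3]; exact div_ne_zero h2 h3), hPQ y h1]
  field_simp

theorem RegAt.eval_comp (P : MvPolynomial ι ℂ) {Φ : (σ → ℂ) → ι → ℂ} {x : σ → ℂ}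
    (hΦ : ∀ i, RegAt (fun y => Φ y i) x) : RegAt (fun y => MvPolynomial.eval (Φ y) P) x := by
  induction P using MvPolynomial.induction_on with
  | C a => simpa using RegAt.const a x
  | add p q hp hq => simpa using hp.add hq
  | mul_X p i hp => simpa using hp.mul (hΦ i)

theorem RegAt.comp {F : (ι → ℂ) → ℂ} {Φ : (σ → ℂ) → ι → ℂ} {x : σ → ℂ} (hF : RegAt F (Φ x))
    (hΦ : ∀ i, RegAt (fun y => Φ y i) x) : RegAt (fun y => F (Φ y)) x := by
  obtain ⟨P, Q, hQ, h⟩ := hF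
  exact ((RegAt.eval_comp P hΦ).div (RegAt.eval_comp Q hΦ) hQ).congr_of_ne
    (RegAt.eval_comp Q hΦ) hQ fun y hy => h _ hy

theorem isOpen_setOf_ne_zero {O : Set (Aff σ)} (hO : IsOpen O) {F : (σ → ℂ) → ℂ}
    (hF : ∀ x ∈ O, RegAt F x) : IsOpen ({x | x ∈ O ∧ F x ≠ 0} : Set (Aff σ)) := by
  refine isOpen_iff_basic.2 fun x hx => ?_
  obtain ⟨P, Q, hQ, h⟩ := hF x hx.1
  obtain ⟨f, hf, hfO⟩ := isOpen_iff_basic.1 hO x hx.1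
  have hP : MvPolynomial.eval x P ≠ 0 := by
    intro hP
    exact hx.2 (by rw [h x hQ, hP, zero_div])
  refine ⟨P * Q * f, by simpa using ⟨⟨hP, hQ⟩, hf⟩, fun y hy => ?_⟩
  simp only [map_mul, mul_ne_zero_iff] at hy
  exact ⟨hfO y hy.2, by rw [h y hy.1.2]; exact div_ne_zero hy.1.1 hy.1.2⟩

theorem isOpen_inter_preimage {O : Set (Aff σ)} (hO : IsOpen O) {Φ : (σ → ℂ) → ι → ℂ}
    (hΦ : ∀ x ∈ O, ∀ i, RegAt (fun y => Φ y i) x) {U : Set (Aff ι)} (hU : IsOpen U) :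
    IsOpen ({x | x ∈ O ∧ Φ x ∈ U} : Set (Aff σ)) := by
  refine isOpen_iff_forall_mem_open.2 fun x hx => ?_
  obtain ⟨f, hf, hfU⟩ := isOpen_iff_basic.1 hU _ hx.2
  refine ⟨_, ?_, isOpen_setOf_ne_zero hO fun z hz => RegAt.eval_comp f (hΦ z hz), hx.1, hf⟩
  exact fun y hy => ⟨hy.1, hfU _ hy.2⟩

theorem continuousOn_of_regAt {O : Set (Aff σ)} (hO : IsOpen O) {Φ : Aff σ → Aff ι}
    (hΦ : ∀ x ∈ O, ∀ i, RegAt (fun y => Φ y i) x) : ContinuousOn Φ O :=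
  (continuousOn_open_iff hO).2 fun _ hU => isOpen_inter_preimage hO hΦ hU

/-- Two non-empty basic open sets meet because the product of two non-zero polynomials is non-zero
and so takes a non-zero value somewhere on the infinite field ℂ. -/
theorem isIrreducible_univ_aff : IsIrreducible (Set.univ : Set (Aff σ)) := by
  refine ⟨⟨fun _ => 0, trivial⟩, ?_⟩
  rintro U V hU hV ⟨x, -, hx⟩ ⟨y, -, hy⟩
  obtain ⟨f, hf, hfU⟩ := isOpen_iff_basic.1 hU x hx
  obtain ⟨g, hg, hgV⟩ := isOpen_iff_basic.1 hV y hy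
  have hfg : f * g ≠ 0 := by
    refine mul_ne_zero ?_ ?_ <;> rintro rfl
    · simp at hf
    · simp at hg
  have : ∃ z, MvPolynomial.eval z (f * g) ≠ 0 := by
    by_contra! h
    exact hfg (MvPolynomial.funext fun z => by simpa using h z)
  obtain ⟨z, hz⟩ := this
  simp only [map_mul, mul_ne_zero_iff] at hz
  exact ⟨z, trivial, hfU z hz.1, hgV z hz.2⟩

theorem isIrreducible_of_isOpen {U : Set (Aff σ)} (hU : IsOpen U) (hne : U.Nonempty) :
    IsIrreducible U :=
  ⟨hne, isIrreducible_univ_aff.2.open_subset hU (Set.subset_univ _)⟩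

end Regular

/-! ### Dimension -/

section Dimension

variable {σ ι : Type*}

open TopologicalSpace Topology

/-- The closed points carry the topology induced from the prime spectrum, whose dimension is that of
the polynomial ring. -/
theorem topologicalKrullDim_aff_le [Fintype ι] :
    topologicalKrullDim (Aff ι) ≤ (Fintype.card ι : WithBot ℕ∞) := by
  let f : Aff ι → PrimeSpectrum (MvPolynomial ι ℂ) := pointToPoint (k := ℂ) (K := ℂ)
  have h : IsInducing f := ⟨rfl⟩
  refine h.topologicalKrullDim_le.trans ?_
  rw [PrimeSpectrum.topologicalKrullDim_eq_ringKrullDim,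
    MvPolynomial.ringKrullDim_of_isNoetherianRing, ringKrullDim_eq_zero_of_field]
  simp

/-- A full flag of coordinate subspaces through a point u of V stays a strict chain of irreducible
closed sets after intersection with V. -/
theorem le_topologicalKrullDim_of_isOpen [Fintype ι] {V : Set (Aff ι)} (hV : IsOpen V)
    (hne : V.Nonempty) : (Fintype.card ι : WithBot ℕ∞) ≤ topologicalKrullDim V := by
  obtain ⟨u, hu⟩ := hne
  let n := Fintype.card ι
  let e : ι ≃ Fin n := Fintype.equivFin ι
  let L : ℕ → Set (Aff ι) := fun i => {x | ∀ j : ι, i ≤ (e j : ℕ) → x j = u j}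
  have hLclosed : ∀ i, IsClosed (L i) := by
    intro i
    refine isClosed_aff_iff.2 ⟨{p | ∃ j : ι, i ≤ (e j : ℕ) ∧ p = X j - C (u j)}, fun x => ?_⟩
    constructor
    · rintro h p ⟨j, hj, rfl⟩
      simpa [sub_eq_zero] using h j hj
    · intro h j hj
      simpa [sub_eq_zero] using h _ ⟨j, hj, rfl⟩
  -- `Φ i` is the projection onto the subspace `L i`, which is therefore irreducible as an image of
  -- affine space.
  let Φ : ℕ → Aff ι → Aff ι := fun i x j => if i ≤ (e j : ℕ) then u j else x j
  have hΦreg : ∀ i (x : Aff ι) j, RegAt (fun y => Φ i y j) x := by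
    intro i x j
    by_cases h : i ≤ (e j : ℕ)
    · simpa [Φ, h] using RegAt.const (u j) x
    · simpa [Φ, h] using RegAt.coord j x
  have hΦL : ∀ i x, Φ i x ∈ L i := fun i x j hj => by simp [Φ, hj]
  have hΦid : ∀ i, ∀ x ∈ L i, Φ i x = x := by
    intro i x hx
    funext j
    by_cases h : i ≤ (e j : ℕ)
    · simp [Φ, h, hx j h]
    · simp [Φ, h]
  have huL : ∀ i, u ∈ L i := fun i j _ => rfl
  have hLirr : ∀ i, IsIrreducible (L i) := by
    intro i
    have himg : L i = Φ i '' Set.univ := by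
      ext x
      constructor
      · intro hx
        exact ⟨x, trivial, hΦid i x hx⟩
      · rintro ⟨y, -, rfl⟩
        exact hΦL i y
    rw [himg]
    exact isIrreducible_univ_aff.image _
      (continuousOn_of_regAt isOpen_univ fun x _ j => hΦreg i x j)
  have hmono : ∀ i, L i ⊆ L (i + 1) := fun i x hx j hj => hx j (by omega)
  have hstrict : ∀ i, i < n → ∃ x ∈ V ∩ L (i + 1), x ∉ L i := by
    intro i hi
    -- Every coordinate of w differs from that of u, so its projection lies in `L (i + 1)` but not
    -- in `L i`. Irreducibility then yields a point that is also mapped into V.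
    let w : Aff ι := fun j => u j + 1
    have hopen := isOpen_inter_preimage (O := Set.univ) isOpen_univ
      (fun x _ j => hΦreg (i + 1) x j) hV
    have hopen' := isOpen_inter_preimage (O := Set.univ) isOpen_univ
      (fun x _ j => hΦreg (i + 1) x j) (hLclosed i).isOpen_compl
    obtain ⟨x, -, hx1, hx2⟩ := isIrreducible_univ_aff.2 _ _ hopen hopen'
      ⟨u, trivial, trivial, by change Φ (i + 1) u ∈ V; rwa [hΦid _ u (huL _)]⟩
      ⟨w, trivial, trivial, fun h => by
        have := h (e.symm ⟨i, hi⟩) (by simp)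
        simp [Φ, w] at this⟩
    exact ⟨_, ⟨hx1.2, hΦL _ _⟩, hx2.2⟩
  have hirr : ∀ i, IsIrreducible (Subtype.val ⁻¹' L i : Set V) := by
    intro i
    exact ⟨⟨⟨u, hu⟩, huL i⟩, (hLirr i).2.preimage hV.isOpenEmbedding_subtypeVal⟩
  let Z : ℕ → IrreducibleCloseds V := fun i =>
    ⟨Subtype.val ⁻¹' L i, hirr i, (hLclosed i).preimage continuous_subtype_val⟩
  rw [topologicalKrullDim, Order.le_krullDim_iff]
  refine ⟨⟨n, fun i => Z i, fun i => ?_⟩, rfl⟩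
  refine lt_of_le_of_ne (show (Z i : Set V) ⊆ Z (i + 1) from fun x hx => hmono _ hx) ?_
  intro heq
  obtain ⟨x, ⟨hxV, hx1⟩, hx2⟩ := hstrict i i.2
  have : (⟨x, hxV⟩ : V) ∈ (Z (i + 1) : Set V) := hx1
  rw [← heq] at this
  exact hx2 this

/-- The dimension is the supremum of the coheights of irreducible closed sets, and the coheight of Z
can be computed in any open set meeting Z. -/
theorem topologicalKrullDim_le_of_cover {T : Type*} [TopologicalSpace T] {d : WithBot ℕ∞}
    (h : ∀ x : T, ∃ U : Set T, IsOpen U ∧ x ∈ U ∧ topologicalKrullDim U ≤ d) :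
    topologicalKrullDim T ≤ d := by
  rw [topologicalKrullDim, Order.krullDim_eq_iSup_coheight]
  refine iSup_le fun Z => ?_
  obtain ⟨x, hx⟩ := Z.isIrreducible.nonempty
  obtain ⟨U, hU, hxU, hUd⟩ := h x
  have hemb : IsOpenEmbedding (Subtype.val : U → T) := hU.isOpenEmbedding_subtypeVal
  let e := IrreducibleCloseds.orderIsoOfIsOpenEmbedding (Subtype.val : U → T) hemb
  let Y := e.symm ⟨Z, ⟨⟨x, hxU⟩, hx⟩⟩
  have hY : IrreducibleCloseds.map _ hemb.continuous Y = Z := by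
    have : (e Y : IrreducibleCloseds T) = Z := by simp [Y]
    exact this
  rw [← hY, hemb.coheight_map]
  exact (Order.coheight_le_krullDim Y).trans hUd

end Dimension

end DeligneSimpson

namespace DeligneSimpson

open MvPolynomial

/-! ### Tangent spaces -/

section Tangent

open Filter Topology

variable {σ ι : Type*}

theorem eventually_eval_ne_zero {f : MvPolynomial σ ℂ} {x : σ → ℂ} (h : eval x f ≠ 0) :
    ∀ᶠ y in 𝓝 x, eval y f ≠ 0 :=
  (MvPolynomial.continuous_eval f).continuousAt.eventually_ne h

theorem eventually_mem_of_isOpen {O : Set (Aff σ)} (hO : IsOpen O) {x : σ → ℂ} (hx : x ∈ O) :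
    (𝓝 x).Eventually fun y : σ → ℂ => y ∈ O := by
  obtain ⟨f, hf, hfO⟩ := isOpen_iff_basic.1 hO x hx
  exact (eventually_eval_ne_zero hf).mono hfO

variable [Fintype σ] [Fintype ι]

/-- The differential of a polynomial. -/
noncomputable def polyDeriv (f : MvPolynomial σ ℂ) (x : σ → ℂ) : (σ → ℂ) →L[ℂ] ℂ :=
  ∑ i, eval x (pderiv i f) • ContinuousLinearMap.proj i

theorem polyDeriv_apply (f : MvPolynomial σ ℂ) (x v : σ → ℂ) :
    polyDeriv f x v = ∑ i, eval x (pderiv i f) * v i := by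
  simp [polyDeriv]

theorem mem_tangentSpace_iff {X : Set (σ → ℂ)} {x v : σ → ℂ} :
    v ∈ tangentSpace X x ↔ ∀ f ∈ vanishingIdeal ℂ X, polyDeriv f x v = 0 := by
  simp only [polyDeriv_apply]
  rfl

theorem hasFDerivAt_eval (f : MvPolynomial σ ℂ) (x : σ → ℂ) :
    HasFDerivAt (fun y => eval y f) (polyDeriv f x) x := by
  classical
  induction f using MvPolynomial.induction_on with
  | C a =>
    have : polyDeriv (C a) x = 0 := by
      ext v
      simp [polyDeriv_apply]
    simpa [this] using hasFDerivAt_const a x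
  | add p q hp hq =>
    have : polyDeriv (p + q) x = polyDeriv p x + polyDeriv q x := by
      ext v
      simp [polyDeriv_apply, add_mul, Finset.sum_add_distrib]
    rw [this]
    simpa only [map_add] using! hp.add hq
  | mul_X p i hp =>
    have : polyDeriv (p * X i) x
        = eval x p • ContinuousLinearMap.proj i + x i • polyDeriv p x := by
      refine ContinuousLinearMap.ext fun v => ?_
      simp only [polyDeriv_apply, Derivation.leibniz, pderiv_X, smul_eq_mul, map_add, map_mul,
        eval_X, add_mul, Finset.sum_add_distrib, add_apply,
        smul_apply, ContinuousLinearMap.proj_apply, Finset.mul_sum, mul_assoc]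
      congr 1
      rw [Finset.sum_eq_single i]
      · simp
      · intro j _ hj
        simp [hj.symm]
      · simp
    rw [this]
    simpa only [map_mul, eval_X] using! hp.mul (hasFDerivAt_apply i x)

theorem RegAt.differentiableAt {F : (σ → ℂ) → ℂ} {x : σ → ℂ} (hF : RegAt F x) :
    DifferentiableAt ℂ F x := by
  obtain ⟨P, Q, hQ, h⟩ := hF
  have hd : DifferentiableAt ℂ (fun y => MvPolynomial.eval y P / MvPolynomial.eval y Q) x :=
    by
    simp only [div_eq_mul_inv]
    exact (hasFDerivAt_eval P x).differentiableAt.mul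
      ((hasFDerivAt_eval Q x).differentiableAt.fun_inv hQ)
  refine hd.congr_of_eventuallyEq ?_
  filter_upwards [eventually_eval_ne_zero hQ] with y hy using h y hy

/-- The tangent space is defined by polynomials vanishing on all of X; clearing denominators extends
the test to regular functions that vanish on X only near x. -/
theorem fderiv_apply_of_mem_tangentSpace {X : Set (σ → ℂ)} {x v : σ → ℂ} (hx : x ∈ X)
    (hv : v ∈ tangentSpace X x) {O : Set (Aff σ)} (hO : IsOpen O) (hxO : x ∈ O)
    {F : (σ → ℂ) → ℂ} (hF : RegAt F x) (h0 : ∀ y ∈ X, y ∈ O → F y = 0) :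
    fderiv ℂ F x v = 0 := by
  have hdF := hF.differentiableAt.hasFDerivAt
  obtain ⟨P, Q, hQ, h⟩ := hF
  obtain ⟨f, hf, hfO⟩ := isOpen_iff_basic.1 hO x hxO
  -- On X the factor f kills points outside O, Q kills points where F need not equal P / Q, and
  -- elsewhere P vanishes with F.
  have hG : P * Q * f ∈ vanishingIdeal ℂ X := by
    intro y hy
    by_cases hQy : eval y Q = 0
    · simp [aeval_eq_eval, hQy]
    by_cases hfy : eval y f = 0
    · simp [aeval_eq_eval, hfy]
    have := h y hQy
    rw [h0 y hy (hfO y hfy), eq_comm, div_eq_zero_iff] at this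
    simp [aeval_eq_eval, this.resolve_right hQy]
  have h1 := mem_tangentSpace_iff.1 hv _ hG
  have h2 : HasFDerivAt (fun y => F y * eval y (Q * Q * f)) (polyDeriv (P * Q * f) x) x := by
    refine (hasFDerivAt_eval (P * Q * f) x).congr_of_eventuallyEq ?_
    filter_upwards [eventually_eval_ne_zero hQ] with y hy
    rw [h y hy]
    simp only [map_mul]
    field_simp
  -- As F x = 0, the product rule leaves only Q(x)² f(x) dF, with a non-zero coefficient.
  have h3 := h2.unique (hdF.mul (hasFDerivAt_eval (Q * Q * f) x))
  rw [h3, h0 x hx hxO] at h1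
  simpa [hQ, hf] using h1

/-- The tangent space is the range of dφ, and dφ is injective because ψ ∘ φ = id on an open set. -/
theorem finrank_tangentSpace_of_chart {X : Set (σ → ℂ)} {x : σ → ℂ} (hx : x ∈ X)
    {φ : (ι → ℂ) → σ → ℂ} {ψ : (σ → ℂ) → ι → ℂ} {V : Set (Aff ι)} {O : Set (Aff σ)}
    (hV : IsOpen V) (hO : IsOpen O) (hxO : x ∈ O) (hxV : ψ x ∈ V)
    (hφ : ∀ k, RegAt (fun u => φ u k) (ψ x)) (hψ : ∀ i, RegAt (fun y => ψ y i) x)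
    (hφX : ∀ u ∈ V, φ u ∈ X) (hψφ : ∀ u ∈ V, ψ (φ u) = u)
    (hφψ : ∀ y ∈ X, y ∈ O → φ (ψ y) = y) :
    Module.finrank ℂ (tangentSpace X x) = Fintype.card ι := by
  have hφd : DifferentiableAt ℂ φ (ψ x) := differentiableAt_pi.2 fun k => (hφ k).differentiableAt
  have hψd : DifferentiableAt ℂ ψ x := differentiableAt_pi.2 fun i => (hψ i).differentiableAt
  have hxx : φ (ψ x) = x := hφψ x hx hxO
  have hinv : (fderiv ℂ ψ x).comp (fderiv ℂ φ (ψ x)) = ContinuousLinearMap.id ℂ (ι → ℂ) := by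
    have h1 : HasFDerivAt (ψ ∘ φ) ((fderiv ℂ ψ x).comp (fderiv ℂ φ (ψ x))) (ψ x) := by
      refine HasFDerivAt.comp _ ?_ hφd.hasFDerivAt
      rw [hxx]
      exact hψd.hasFDerivAt
    refine h1.unique ((hasFDerivAt_id _).congr_of_eventuallyEq ?_)
    exact (eventually_mem_of_isOpen hV hxV).mono hψφ
  have hrange : tangentSpace X x = LinearMap.range (fderiv ℂ φ (ψ x)).toLinearMap := by
    apply le_antisymm
    · intro v hv
      refine ⟨fderiv ℂ ψ x v, ?_⟩
      funext k
      -- φ ∘ ψ is the identity only on X, so dφ(dψ v) = v is obtained for tangent vectors v by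
      -- testing them against the functions φ ∘ ψ − id.
      have hreg : RegAt (fun y => φ (ψ y) k - y k) x :=
        ((hφ k).comp (F := fun u => φ u k) hψ).sub (RegAt.coord k x)
      have h1 := fderiv_apply_of_mem_tangentSpace hx hv hO hxO hreg
        fun y hy hyO => by rw [hφψ y hy hyO, sub_self]
      have h2 : HasFDerivAt (fun y => φ (ψ y))
          ((fderiv ℂ φ (ψ x)).comp (fderiv ℂ ψ x)) x :=
        hφd.hasFDerivAt.comp x hψd.hasFDerivAt
      have h3 : HasFDerivAt (fun y => φ (ψ y) k - y k) _ x :=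
        (hasFDerivAt_pi'.1 h2 k).sub (hasFDerivAt_apply k x)
      rw [h3.fderiv] at h1
      simpa [sub_eq_zero] using h1
    · rintro _ ⟨w, rfl⟩
      refine mem_tangentSpace_iff.2 fun f hf => ?_
      have h1 : HasFDerivAt (fun u => eval (φ u) f)
          ((polyDeriv f x).comp (fderiv ℂ φ (ψ x))) (ψ x) := by
        refine HasFDerivAt.comp (g := fun y => eval y f) _ ?_ hφd.hasFDerivAt
        rw [hxx]
        exact hasFDerivAt_eval f x
      have h2 : (polyDeriv f x).comp (fderiv ℂ φ (ψ x)) = 0 := by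
        refine h1.unique ((hasFDerivAt_const (0 : ℂ) _).congr_of_eventuallyEq ?_)
        exact (eventually_mem_of_isOpen hV hxV).mono fun u hu => hf _ (hφX u hu)
      exact DFunLike.congr_fun h2 w
  rw [hrange, LinearMap.finrank_range_of_inj, Module.finrank_fintype_fun_eq_card]
  intro w w' h
  have h' := congrArg (fderiv ℂ ψ x) h
  have key : ∀ w, fderiv ℂ ψ x ((fderiv ℂ φ (ψ x)).toLinearMap w) = w :=
    fun w => DFunLike.congr_fun hinv w
  rwa [key, key] at h'

/-- An irreducible set that is locally, in the Zariski topology, isomorphic to an open subset of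
an affine space is a smooth variety. -/
theorem isIrreducibleSmoothVariety_of_charts {X : Set (Aff σ)}
    (hirr : IsIrreducible X)
    (h : ∀ x ∈ X, ∃ (φ : (ι → ℂ) → σ → ℂ) (ψ : (σ → ℂ) → ι → ℂ) (V : Set (Aff ι))
      (O : Set (Aff σ)), IsOpen V ∧ IsOpen O ∧ x ∈ O ∧
        (∀ u ∈ V, ∀ k, RegAt (fun u => φ u k) u) ∧ (∀ y ∈ O, ∀ i, RegAt (fun y => ψ y i) y) ∧
        (∀ u ∈ V, φ u ∈ X ∧ φ u ∈ O ∧ ψ (φ u) = u) ∧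
        ∀ y ∈ X, y ∈ O → ψ y ∈ V ∧ φ (ψ y) = y) :
    IsIrreducibleSmoothVariety (σ := σ) X (Fintype.card ι) := by
  refine ⟨?_, hirr, ?_, ?_⟩
  · change IsLocallyClosed X
    refine ((isLocallyClosed_tfae X).out 0 3).2 fun x hx => ?_
    obtain ⟨φ, ψ, V, O, hV, hO, hxO, hφ, hψ, hφV, hψO⟩ := h x hx
    have hΩ := isOpen_inter_preimage hO hψ hV
    refine ⟨{y | y ∈ O ∧ ψ y ∈ V}, ⟨hxO, (hψO x hx hxO).1⟩, hΩ, ?_⟩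
    rintro y ⟨⟨hyO, hyV⟩, hyX⟩
    -- Inside the open set where ψ lands in V, the equation φ(ψ y) = y is closed and holds on X,
    -- hence on the closure of X; and any solution lies in X.
    suffices hy : φ (ψ y) = y by
      rw [← hy]
      exact (hφV _ hyV).1
    funext k
    by_contra hne
    have hopen := isOpen_setOf_ne_zero hΩ (F := fun y => φ (ψ y) k - y k) fun z hz =>
      ((hφ _ hz.2 k).comp (F := fun u => φ u k) (hψ z hz.1)).sub (RegAt.coord k z)
    obtain ⟨z, hz, hzX⟩ := mem_closure_iff.1 hyX _ hopen ⟨⟨hyO, hyV⟩, sub_ne_zero.2 hne⟩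
    exact hz.2 (by rw [(hψO z hzX hz.1.1).2, sub_self])
  · change topologicalKrullDim X = (Fintype.card ι : WithBot ℕ∞)
    have hhomeo : ∀ x : X, ∃ U : Set X, IsOpen U ∧ x ∈ U ∧
        topologicalKrullDim U = (Fintype.card ι : WithBot ℕ∞) := by
      rintro ⟨x, hx⟩
      obtain ⟨φ, ψ, V, O, hV, hO, hxO, hφ, hψ, hφV, hψO⟩ := h x hx
      refine ⟨Subtype.val ⁻¹' O, hO.preimage continuous_subtype_val, hxO, ?_⟩
      let f : (Subtype.val ⁻¹' O : Set X) → V :=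
        fun y => ⟨ψ y.1.1, (hψO _ y.1.2 y.2).1⟩
      let g : V → (Subtype.val ⁻¹' O : Set X) :=
        fun u => ⟨⟨φ u.1, (hφV _ u.2).1⟩, (hφV _ u.2).2.1⟩
      have hf : Continuous f := by
        refine Continuous.subtype_mk ?_ _
        exact (continuousOn_of_regAt hO hψ).comp_continuous
          (continuous_subtype_val.comp continuous_subtype_val) fun y => y.2
      have hg : Continuous g := by
        refine Continuous.subtype_mk (Continuous.subtype_mk ?_ _) _
        exact (continuousOn_of_regAt hV hφ).comp_continuous continuous_subtype_val fun u => u.2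
      let e : (Subtype.val ⁻¹' O : Set X) ≃ₜ V :=
        { toFun := f
          invFun := g
          left_inv := fun y => Subtype.ext (Subtype.ext (hψO _ y.1.2 y.2).2)
          right_inv := fun u => Subtype.ext (hφV _ u.2).2.2
          continuous_toFun := hf
          continuous_invFun := hg }
      rw [e.isHomeomorph.topologicalKrullDim_eq]
      exact le_antisymm ((topologicalKrullDim_subspace_le _ V).trans topologicalKrullDim_aff_le)
        (le_topologicalKrullDim_of_isOpen hV ⟨_, (hψO x hx hxO).1⟩)
    apply le_antisymm
    · refine topologicalKrullDim_le_of_cover fun x => ?_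
      obtain ⟨U, hU, hxU, hd⟩ := hhomeo x
      exact ⟨U, hU, hxU, hd.le⟩
    · obtain ⟨x, hx⟩ := hirr.1
      obtain ⟨U, -, -, hd⟩ := hhomeo ⟨x, hx⟩
      rw [← hd]
      exact topologicalKrullDim_subspace_le _ U
  · intro x hx
    obtain ⟨φ, ψ, V, O, hV, hO, hxO, hφ, hψ, hφV, hψO⟩ := h x hx
    have hxV := (hψO x hx hxO).1
    exact finrank_tangentSpace_of_chart hx hV hO hxO hxV (hφ _ hxV) (hψ x hxO)
      (fun u hu => (hφV u hu).1) (fun u hu => (hφV u hu).2.2) fun y hy hyO => (hψO y hy hyO).2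

end Tangent

end DeligneSimpson

namespace DeligneSimpson

open MvPolynomial

/-! ### Regular matrix-valued functions -/

section RegularMatrices

variable {σ ι l m n : Type*}

/-- All entries of the matrix-valued function `F` are regular at `x`. -/
def RegMatAt (F : (σ → ℂ) → Matrix m n ℂ) (x : σ → ℂ) : Prop :=
  ∀ i j, RegAt (fun y => F y i j) x

theorem RegMatAt.const (A : Matrix m n ℂ) (x : σ → ℂ) : RegMatAt (fun _ => A) x :=
  fun i j => RegAt.const (A i j) x

theorem RegMatAt.add {F G : (σ → ℂ) → Matrix m n ℂ} {x : σ → ℂ} (hF : RegMatAt F x)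
    (hG : RegMatAt G x) : RegMatAt (fun y => F y + G y) x :=
  fun i j => (hF i j).add (hG i j)

theorem RegMatAt.sub {F G : (σ → ℂ) → Matrix m n ℂ} {x : σ → ℂ} (hF : RegMatAt F x)
    (hG : RegMatAt G x) : RegMatAt (fun y => F y - G y) x :=
  fun i j => (hF i j).sub (hG i j)

theorem RegMatAt.mul [Fintype m] {F : (σ → ℂ) → Matrix l m ℂ} {G : (σ → ℂ) → Matrix m n ℂ}
    {x : σ → ℂ} (hF : RegMatAt F x) (hG : RegMatAt G x) : RegMatAt (fun y => F y * G y) x := by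
  intro i j
  simp only [Matrix.mul_apply]
  exact RegAt.sum _ fun k _ => (hF i k).mul (hG k j)

theorem RegMatAt.smul {f : (σ → ℂ) → ℂ} {F : (σ → ℂ) → Matrix m n ℂ} {x : σ → ℂ}
    (hf : RegAt f x) (hF : RegMatAt F x) : RegMatAt (fun y => f y • F y) x :=
  fun i j => hf.mul (hF i j)

theorem RegMatAt.sum {α : Type*} (s : Finset α) {F : α → (σ → ℂ) → Matrix m n ℂ} {x : σ → ℂ}
    (hF : ∀ a ∈ s, RegMatAt (F a) x) : RegMatAt (fun y => ∑ a ∈ s, F a y) x := by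
  intro i j
  simp only [Matrix.sum_apply]
  exact RegAt.sum _ fun a ha => hF a ha i j

theorem RegMatAt.fromBlocks {k : Type*} {F : (σ → ℂ) → Matrix k l ℂ} {G : (σ → ℂ) → Matrix k n ℂ}
    {H : (σ → ℂ) → Matrix m l ℂ} {L : (σ → ℂ) → Matrix m n ℂ} {x : σ → ℂ}
    (hF : RegMatAt F x) (hG : RegMatAt G x) (hH : RegMatAt H x) (hL : RegMatAt L x) :
    RegMatAt (fun y => Matrix.fromBlocks (F y) (G y) (H y) (L y)) x := by
  rintro (i | i) (j | j)
  exacts [hF i j, hG i j, hH i j, hL i j]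

variable [Fintype m]

theorem RegMatAt.trace {F : (σ → ℂ) → Matrix m m ℂ} {x : σ → ℂ} (hF : RegMatAt F x) :
    RegAt (fun y => (F y).trace) x :=
  RegAt.sum _ fun i _ => hF i i

variable [DecidableEq m]

theorem RegMatAt.det {F : (σ → ℂ) → Matrix m m ℂ} {x : σ → ℂ} (hF : RegMatAt F x) :
    RegAt (fun y => (F y).det) x := by
  simp only [Matrix.det_apply']
  exact RegAt.sum _ fun g _ => (RegAt.const _ x).mul (RegAt.prod _ fun i _ => hF _ _)

theorem RegMatAt.inv {F : (σ → ℂ) → Matrix m m ℂ} {x : σ → ℂ} (hF : RegMatAt F x)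
    (h0 : (F x).det ≠ 0) : RegMatAt (fun y => (F y)⁻¹) x := by
  simp only [Matrix.inv_def, Ring.inverse_eq_inv']
  refine RegMatAt.smul (hF.det.inv h0) fun i j => ?_
  simp only [Matrix.adjugate_apply]
  refine RegMatAt.det fun k l => ?_
  by_cases hk : k = j
  · subst hk
    simpa using RegAt.const _ x
  · simpa [Matrix.updateRow_ne hk] using hF k l

theorem RegMatAt.freeAlgebra_lift {α : Type*} {F : (σ → ℂ) → α → Matrix m m ℂ} {x : σ → ℂ}
    (hF : ∀ a, RegMatAt (fun y => F y a) x) (p : FreeAlgebra ℂ α) :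
    RegMatAt (fun y => FreeAlgebra.lift ℂ (F y) p) x := by
  induction p using FreeAlgebra.induction with
  | grade0 r => simpa using RegMatAt.const _ x
  | grade1 a => simpa using hF a
  | mul p q hp hq => simpa using hp.mul hq
  | add p q hp hq => simpa using hp.add hq

end RegularMatrices

end DeligneSimpson

namespace DeligneSimpson

/-! ### Two by two matrices over the dual numbers -/

section Dual

/-- Matrices of size two over the dual numbers. -/
abbrev DMat2 : Type := Matrix (Fin 2) (Fin 2) (DualNumber ℂ)

/-- The reduction of a matrix modulo `ε`. -/
noncomputable def red : DMat2 →ₐ[ℂ] Mat2 := (TrivSqZeroExt.fstHom ℂ ℂ ℂ).mapMatrix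

theorem red_apply (A : DMat2) (i j : Fin 2) : red A i j = (A i j).fst := rfl

/-- The matrix `N + ε R`. -/
noncomputable def dual (N R : Mat2) : DMat2 :=
  fun i j => TrivSqZeroExt.inl (N i j) + TrivSqZeroExt.inr (R i j)

/-- The coefficient of `ε` in a matrix. -/
def infPart (A : DMat2) : Mat2 := fun i j => (A i j).snd

@[simp] theorem red_dual (N R : Mat2) : red (dual N R) = N := by
  ext i j
  simp [red_apply, dual]

@[simp] theorem infPart_dual (N R : Mat2) : infPart (dual N R) = R := by
  ext i j
  simp [infPart, dual]

theorem dual_red_infPart (A : DMat2) : dual (red A) (infPart A) = A := by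
  ext i j <;> simp [infPart, dual, red_apply]

theorem infPart_mul (A B : DMat2) :
    infPart (A * B) = red A * infPart B + infPart A * red B := by
  ext i j
  simp [infPart, red_apply, Matrix.mul_apply]
  ring

theorem isUnit_dualNumber_iff (x : DualNumber ℂ) : IsUnit x ↔ x.fst ≠ 0 := by
  rw [TrivSqZeroExt.isUnit_iff_isUnit_fst, isUnit_iff_ne_zero]

theorem fst_det (A : DMat2) : A.det.fst = (red A).det := by
  simp [Matrix.det_fin_two, red_apply]

theorem isUnit_of_det_red_ne_zero {A : DMat2} (h : (red A).det ≠ 0) : IsUnit A := by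
  rw [Matrix.isUnit_iff_isUnit_det, isUnit_dualNumber_iff, fst_det]
  exact h

/-- The block matrix `(N, R; 0, N)` of the matrix `N + ε R`. -/
noncomputable def blockHom : DMat2 →ₐ[ℂ] Mat4 where
  toFun A := Matrix.fromBlocks (red A) (infPart A) 0 (red A)
  map_one' := by
    rw [← Matrix.fromBlocks_one, map_one]
    congr 1
    ext i j
    by_cases h : i = j <;> simp [infPart, Matrix.one_apply, h]
  map_mul' A B := by
    rw [Matrix.fromBlocks_multiply, infPart_mul, map_mul]
    simp
  map_zero' := by
    rw [← Matrix.fromBlocks_zero, map_zero]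
    rfl
  map_add' A B := by
    rw [Matrix.fromBlocks_add, map_add]
    simp
    rfl
  commutes' r := by
    rw [AlgHom.commutes]
    ext (i | i) (j | j) <;>
    by_cases h : i = j <;>
      simp [infPart, Matrix.algebraMap_matrix_apply, h, TrivSqZeroExt.algebraMap_eq_inl]

theorem blockHom_apply (A : DMat2) :
    blockHom A = Matrix.fromBlocks (red A) (infPart A) 0 (red A) := rfl

theorem blockHom_dual (N R : Mat2) : blockHom (dual N R) = Matrix.fromBlocks N R 0 N := by
  simp [blockHom_apply]

theorem blockHom_injective : Function.Injective blockHom := by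
  intro A B h
  rw [blockHom_apply, blockHom_apply, Matrix.fromBlocks_inj] at h
  rw [← dual_red_infPart A, ← dual_red_infPart B, h.1, h.2.1]

theorem det_blockHom (A : DMat2) : (blockHom A).det = (red A).det * (red A).det := by
  rw [blockHom_apply, Matrix.det_fromBlocks_zero₂₁]

/-- The eigenvectors of two by two matrices over a commutative ring. -/
theorem mul_eigenvectorMatrix {R : Type*} [CommRing R] {A : Matrix (Fin 2) (Fin 2) R} {a b : R}
    (ht : A.trace = a + b) (hd : A.det = a * b) (i j : Fin 2) :
    A * Matrix.of (fun k => ![A k i - if k = i then b else 0, A k j - if k = j then a else 0]) =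
      Matrix.of (fun k => ![A k i - if k = i then b else 0, A k j - if k = j then a else 0]) *
        Matrix.diagonal ![a, b] := by
  rw [Matrix.trace_fin_two] at ht
  rw [Matrix.det_fin_two] at hd
  -- By Cayley–Hamilton (A − a)(A − b) = 0, so columns of A − b are eigenvectors for a, and columns
  -- of A − a for b.
  ext k l
  fin_cases i <;> fin_cases j <;> fin_cases k <;> fin_cases l <;>
    simp [Matrix.mul_apply, Fin.sum_univ_two, Matrix.diagonal_apply] <;> grind

/-- A pair of two by two matrices over a commutative ring becomes a triangular matrix and a
companion matrix in a basis `u, B u`, where `u` is an eigenvector of `A`. -/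
theorem mul_cyclicMatrix {R : Type*} [CommRing R] {A B : Matrix (Fin 2) (Fin 2) R} {a b s d : R}
    (ht : A.trace = a + b) (hd : A.det = a * b) (hs : B.trace = s) (hd' : B.det = d) (i : Fin 2)
    {u : Fin 2 → R} (hu : u = fun k => A k i - if k = i then b else 0) :
    A * Matrix.of (fun k => ![u k, B.mulVec u k]) =
        Matrix.of (fun k => ![u k, B.mulVec u k]) * !![a, (A * B).trace - b * s; 0, b] ∧
      B * Matrix.of (fun k => ![u k, B.mulVec u k]) =
        Matrix.of (fun k => ![u k, B.mulVec u k]) * !![0, -d; 1, s] := by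
  rw [Matrix.trace_fin_two] at ht hs
  rw [Matrix.det_fin_two] at hd hd'
  subst hu
  -- The corner entry y is forced: the product of the triangular and the companion matrix has trace
  -- y + b s, which must be the trace of A B.
  constructor <;> ext k l <;> fin_cases i <;> fin_cases k <;> fin_cases l <;>
    simp [Matrix.mul_apply, Fin.sum_univ_two, Matrix.mulVec, dotProduct, Matrix.trace_fin_two] <;>
    grind

end Dual

end DeligneSimpson

namespace DeligneSimpson

open TrivSqZeroExt

/-! ### Quadruples of matrices over the dual numbers -/

section Quadruples

variable {lam : Fin 3 → Fin 2 → ℂ} {c : ℂ}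

theorem IsRelativelyGenericNotGeneric.scalar_ne_zero (h : IsRelativelyGenericNotGeneric lam c) :
    c ≠ 0 := by
  rintro rfl
  simpa using h.basic

/-- Such a product would be a non-genericity relation with one index per class, whereas a halving
must pick two of the four copies of c. -/
theorem IsRelativelyGenericNotGeneric.prod_ne_one (h : IsRelativelyGenericNotGeneric lam c)
    (i j k : Fin 2) : lam 0 i * lam 1 j * lam 2 k * c ≠ 1 := by
  intro hp
  have hrel : IsNonGenericityRelation (eigenvalues lam c)
      ![{Sum.inl i}, {Sum.inl j}, {Sum.inl k}, {Sum.inl 0}] := by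
    refine ⟨⟨1, one_pos, by norm_num, fun l => ?_⟩, ?_⟩
    · fin_cases l <;> rfl
    · simpa [Fin.prod_univ_four, eigenvalues] using hp
  have := h.only_basic _ hrel 3 c
  have h1 : {l : Fin 2 ⊕ Fin 2 | l ∈ (![{Sum.inl i}, {Sum.inl j}, {Sum.inl k}, {Sum.inl 0}] :
      Fin 4 → Finset (Fin 2 ⊕ Fin 2)) 3 ∧ eigenvalues lam c 3 l = c} = {Sum.inl 0} := by
    ext l
    simp [eigenvalues]
  have h2 : {l : Fin 2 ⊕ Fin 2 | eigenvalues lam c 3 l = c} = Set.univ := by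
    ext l
    simp [eigenvalues]
  rw [h1, h2, Set.ncard_singleton, Set.ncard_univ] at this
  simp at this

theorem eigenvalue_eq_or_eq {N : Mat2} {a b μ : ℂ} (ht : N.trace = a + b) (hd : N.det = a * b)
    {v : Fin 2 → ℂ} (hv : v ≠ 0) (h : N.mulVec v = μ • v) : μ = a ∨ μ = b := by
  rw [Matrix.trace_fin_two] at ht
  rw [Matrix.det_fin_two] at hd
  have e0 := congrFun h 0
  have e1 := congrFun h 1
  simp only [Matrix.mulVec, dotProduct, Fin.sum_univ_two, Pi.smul_apply, smul_eq_mul] at e0 e1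
  have k0 : (μ - a) * (μ - b) * v 0 = 0 := by grind
  have k1 : (μ - a) * (μ - b) * v 1 = 0 := by grind
  by_contra! hne
  have hab : (μ - a) * (μ - b) ≠ 0 := mul_ne_zero (sub_ne_zero.2 hne.1) (sub_ne_zero.2 hne.2)
  refine hv (funext fun i => ?_)
  fin_cases i
  · exact (mul_eq_zero.1 k0).resolve_left hab
  · exact (mul_eq_zero.1 k1).resolve_left hab

theorem exists_fin_two_eq {x : Fin 2 → ℂ} {μ : ℂ} (h : μ = x 0 ∨ μ = x 1) : ∃ i, μ = x i :=
  h.elim (fun h => ⟨0, h⟩) fun h => ⟨1, h⟩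

/-- Quadruples `N` of matrices with product one, with `N 3` scalar and with the prescribed
characteristic polynomials of the other matrices. -/
structure HasData (lam : Fin 3 → Fin 2 → ℂ) (c : ℂ) (N : Fin 4 → Mat2) : Prop where
  trace_eq : ∀ j : Fin 3, (N j.castSucc).trace = lam j 0 + lam j 1
  det_eq : ∀ j : Fin 3, (N j.castSucc).det = lam j 0 * lam j 1
  last_eq : N 3 = c • (1 : Mat2)
  prod_eq : N 0 * N 1 * N 2 * N 3 = 1

/-- As N 3 is scalar and the product is 1, a common eigenvector of N 0 and N 1 is also one of N 2,
and the eigenvalues on it give a forbidden relation of length one. -/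
theorem HasData.false_of_eigenvector (h : IsRelativelyGenericNotGeneric lam c)
    {N : Fin 4 → Mat2} (hN : HasData lam c N) {v : Fin 2 → ℂ} (hv : v ≠ 0) {μ ν : ℂ}
    (h0 : (N 0).mulVec v = μ • v) (h1 : (N 1).mulVec v = ν • v) : False := by
  have hprod : N 2 * N 3 * (N 0 * N 1) = 1 := by
    rw [mul_eq_one_comm, ← mul_assoc]
    exact hN.prod_eq
  have h2 : (c * μ * ν) • (N 2).mulVec v = v := by
    have := congrArg (fun A : Mat2 => A.mulVec v) hprod
    simp only [hN.last_eq, Matrix.one_mulVec, ← Matrix.mulVec_mulVec, h1, Matrix.mulVec_smul, h0,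
      Matrix.mul_smul, mul_one, Matrix.smul_mulVec] at this
    simpa only [smul_smul, mul_comm, mul_left_comm] using this
  have hne : c * μ * ν ≠ 0 := by
    intro h0
    rw [h0, zero_smul] at h2
    exact hv h2.symm
  have h2' : (N 2).mulVec v = (c * μ * ν)⁻¹ • v := by
    rw [eq_inv_smul_iff₀ hne]
    exact h2
  obtain ⟨i, hi⟩ := exists_fin_two_eq (eigenvalue_eq_or_eq (hN.trace_eq 0) (hN.det_eq 0) hv h0)
  obtain ⟨j, hj⟩ := exists_fin_two_eq (eigenvalue_eq_or_eq (hN.trace_eq 1) (hN.det_eq 1) hv h1)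
  obtain ⟨k, hk⟩ := exists_fin_two_eq (eigenvalue_eq_or_eq (hN.trace_eq 2) (hN.det_eq 2) hv h2')
  refine h.prod_ne_one i j k ?_
  rw [← hi, ← hj, ← hk]
  linear_combination mul_inv_cancel₀ hne

/-- The trace of N − b is a − b ≠ 0. This supplies a non-zero column of N − b, that is, an
eigenvector for a. -/
theorem exists_sub_ne_zero {N : Mat2} {a b : ℂ} (hab : a ≠ b) (ht : N.trace = a + b) :
    ∃ i k, N k i - (if k = i then b else 0) ≠ 0 := by
  by_contra! h
  have h0 := h 0 0
  have h1 := h 1 1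
  rw [Matrix.trace_fin_two] at ht
  simp only [if_true] at h0 h1
  exact hab (by linear_combination h0 + h1 - ht)

theorem det_ne_zero_of_mul_eq_mul_diagonal {N U : Mat2} {a b : ℂ} (hab : a ≠ b)
    (h : N * U = U * Matrix.diagonal ![a, b]) (h0 : ∃ k, U k 0 ≠ 0) (h1 : ∃ k, U k 1 ≠ 0) :
    U.det ≠ 0 := by
  intro hdet
  obtain ⟨v, hv, hUv⟩ := Matrix.exists_mulVec_eq_zero_iff.2 hdet
  have hU : ∀ k, U k 0 * v 0 + U k 1 * v 1 = 0 := by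
    intro k
    simpa [Matrix.mulVec, dotProduct, Fin.sum_univ_two] using congrFun hUv k
  have hN : ∀ k, U k 0 * (a * v 0) + U k 1 * (b * v 1) = 0 := by
    intro k
    have := congrArg (fun A : Mat2 => A.mulVec v k) h
    simp only [← Matrix.mulVec_mulVec, hUv, Matrix.mulVec_zero, Pi.zero_apply] at this
    simpa [Matrix.mulVec, dotProduct, Fin.sum_univ_two, Matrix.diagonal_apply, eq_comm] using this
  have hab' : a - b ≠ 0 := sub_ne_zero.2 hab
  obtain ⟨k, hk⟩ := h0
  obtain ⟨l, hl⟩ := h1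
  have v0 : v 0 = 0 := by
    have : (a - b) * U k 0 * v 0 = 0 := by linear_combination hN k - b * hU k
    simpa [hab', hk] using this
  have v1 : v 1 = 0 := by
    have : (a - b) * U l 1 * v 1 = 0 := by linear_combination a * hU l - hN l
    simpa [hab', hl] using this
  exact hv (funext fun i => by fin_cases i <;> assumption)

/-- The matrix of eigenvectors is invertible over ℂ[ε] because it is so modulo ε, where the
eigenvalues are distinct. -/
theorem exists_eq_conj_diagonal {A : DMat2} {a b : ℂ} (hab : a ≠ b)
    (ht : A.trace = inl a + inl b) (hd : A.det = inl a * inl b) :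
    ∃ P : DMat2ˣ, A = (P : DMat2) * Matrix.diagonal ![inl a, inl b] * ((P⁻¹ : DMat2ˣ) : DMat2) := by
  have ht' : (red A).trace = a + b := by
    simpa [Matrix.trace_fin_two, red_apply] using congrArg fst ht
  obtain ⟨i, k, hk⟩ := exists_sub_ne_zero hab ht'
  obtain ⟨j, l, hl⟩ := exists_sub_ne_zero hab.symm (ht'.trans (add_comm _ _))
  have h := mul_eigenvectorMatrix ht hd i j
  set U : DMat2 := Matrix.of fun k => ![A k i - if k = i then inl b else 0,
    A k j - if k = j then inl a else 0] with hU
  have hUdet : (red U).det ≠ 0 := by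
    have hred := congrArg red h
    rw [map_mul, map_mul] at hred
    refine det_ne_zero_of_mul_eq_mul_diagonal (N := red A) hab ?_ ⟨k, ?_⟩ ⟨l, ?_⟩
    · rw [hred]
      congr 1
      ext p q
      fin_cases p <;> fin_cases q <;> simp [red_apply]
    · convert hk using 1
      by_cases hki : k = i <;> simp [red_apply, hU, hki]
    · convert hl using 1
      by_cases hlj : l = j <;> simp [red_apply, hU, hlj]
  obtain ⟨P, hP⟩ := isUnit_of_det_red_ne_zero hUdet
  refine ⟨P, ?_⟩
  rw [Units.eq_mul_inv_iff_mul_eq, hP, h]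

/-- Quadruples of matrices over the dual numbers with product one, with the prescribed
characteristic polynomials of the first three, whose last matrix is `c + ε n` with a non-zero
nilpotent matrix `n`. -/
structure IsDualQuadruple (lam : Fin 3 → Fin 2 → ℂ) (c : ℂ) (A : Fin 4 → DMat2) : Prop where
  trace_eq : ∀ j : Fin 3, (A j.castSucc).trace = inl (lam j 0) + inl (lam j 1)
  det_eq : ∀ j : Fin 3, (A j.castSucc).det = inl (lam j 0) * inl (lam j 1)
  red_last : red (A 3) = c • (1 : Mat2)
  trace_inf : (infPart (A 3)).trace = 0
  det_inf : (infPart (A 3)).det = 0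
  inf_ne_zero : infPart (A 3) ≠ 0
  prod_eq : A 0 * A 1 * A 2 * A 3 = 1

theorem IsDualQuadruple.hasData_red {A : Fin 4 → DMat2} (hA : IsDualQuadruple lam c A) :
    HasData lam c fun j => red (A j) where
  trace_eq j := by
    simpa [Matrix.trace_fin_two, red_apply] using congrArg fst (hA.trace_eq j)
  det_eq j := by
    rw [← fst_det, hA.det_eq j]
    simp
  last_eq := hA.red_last
  prod_eq := by
    rw [← map_mul, ← map_mul, ← map_mul, hA.prod_eq, map_one]

theorem red_inv_mul (P : DMat2ˣ) : red ↑P⁻¹ * red ↑P = 1 := by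
  rw [← map_mul, Units.inv_mul, map_one]

/-- The constant term is central, so the ε-part of P does not contribute. -/
theorem infPart_conj_of_red_eq_smul {A : DMat2} (hA : red A = c • (1 : Mat2)) (P : DMat2ˣ) :
    infPart (↑P⁻¹ * A * ↑P) = red ↑P⁻¹ * infPart A * red ↑P := by
  have h : infPart (↑P⁻¹ * ↑P : DMat2) = 0 := by
    rw [Units.inv_mul]
    ext i j
    by_cases h : i = j <;> simp [infPart, Matrix.one_apply, h]
  rw [infPart_mul] at h
  rw [infPart_mul, infPart_mul, map_mul, hA]
  simp only [mul_smul_comm, mul_one, smul_mul_assoc, add_mul]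
  rw [add_comm (_ * _ * _), ← add_assoc, ← smul_add, h, smul_zero, zero_add]

theorem trace_units_conj {n R : Type*} [Fintype n] [DecidableEq n] [CommRing R]
    (P : (Matrix n n R)ˣ) (A : Matrix n n R) :
    (((P⁻¹ : (Matrix n n R)ˣ) : Matrix n n R) * A * (P : Matrix n n R)).trace = A.trace := by
  rw [Matrix.trace_mul_comm, ← mul_assoc, Units.mul_inv, one_mul]

theorem det_units_conj {n R : Type*} [Fintype n] [DecidableEq n] [CommRing R]
    (P : (Matrix n n R)ˣ) (A : Matrix n n R) :
    (((P⁻¹ : (Matrix n n R)ˣ) : Matrix n n R) * A * (P : Matrix n n R)).det = A.det := by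
  rw [Matrix.det_mul_comm, ← mul_assoc, Units.mul_inv, one_mul]

theorem IsDualQuadruple.conj {A : Fin 4 → DMat2} (hA : IsDualQuadruple lam c A) (P : DMat2ˣ) :
    IsDualQuadruple lam c fun j => ↑P⁻¹ * A j * ↑P := by
  have hP := infPart_conj_of_red_eq_smul hA.red_last P
  let Q : Mat2ˣ := Units.map (red : DMat2 →* Mat2) P
  have hP' : infPart (↑P⁻¹ * A 3 * ↑P) = ((Q⁻¹ : Mat2ˣ) : Mat2) * infPart (A 3) * (Q : Mat2) := hP
  refine ⟨fun j => ?_, fun j => ?_, ?_, ?_, ?_, ?_, ?_⟩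
  · rw [trace_units_conj, hA.trace_eq]
  · rw [det_units_conj, hA.det_eq]
  · rw [map_mul, map_mul, hA.red_last, mul_smul_comm, mul_one, smul_mul_assoc, red_inv_mul]
  · rw [hP', trace_units_conj, hA.trace_inf]
  · rw [hP', det_units_conj, hA.det_inf]
  · rw [hP']
    intro h0
    refine hA.inf_ne_zero ?_
    have := congrArg (fun B : Mat2 => (Q : Mat2) * B * ((Q⁻¹ : Mat2ˣ) : Mat2)) h0
    simpa [mul_assoc] using this
  · have := hA.prod_eq
    calc _ = ((P⁻¹ : DMat2ˣ) : DMat2) * (A 0 * A 1 * A 2 * A 3) * (P : DMat2) := by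
          simp [mul_assoc]
      _ = 1 := by rw [this]; simp

end Quadruples

end DeligneSimpson

namespace DeligneSimpson

open TrivSqZeroExt

/-! ### Normal forms of quadruples -/

section NormalForm

variable {lam : Fin 3 → Fin 2 → ℂ} {c : ℂ}

/-- The first matrix of the normal form. -/
noncomputable def normalFst (lam : Fin 3 → Fin 2 → ℂ) (c : ℂ) : Mat2 :=
  !![lam 0 0, (lam 2 0 + lam 2 1) * c * (lam 0 0 * lam 0 1) * (lam 1 0 * lam 1 1) -
    lam 0 1 * (lam 1 0 + lam 1 1); 0, lam 0 1]

/-- The second matrix of the normal form. -/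
noncomputable def normalSnd (lam : Fin 3 → Fin 2 → ℂ) : Mat2 :=
  !![0, -(lam 1 0 * lam 1 1); 1, lam 1 0 + lam 1 1]

/-- The normal form of the quadruples over the dual numbers whose last matrix is `c + ε n`. -/
noncomputable def normalFamily (lam : Fin 3 → Fin 2 → ℂ) (c : ℂ) (n : Mat2) : Fin 4 → DMat2 :=
  ![dual (normalFst lam c)
      (Matrix.single 0 1 (-(c⁻¹ * (n * (normalFst lam c * normalSnd lam)).trace))),
    dual (normalSnd lam) 0,
    (inl (lam 2 0 * lam 2 1) : DualNumber ℂ) • (dual (c • 1) n *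
      (dual (normalFst lam c)
        (Matrix.single 0 1 (-(c⁻¹ * (n * (normalFst lam c * normalSnd lam)).trace))) *
      dual (normalSnd lam) 0)).adjugate,
    dual (c • 1) n]

theorem normalFamily_two (lam : Fin 3 → Fin 2 → ℂ) (c : ℂ) (n : Mat2) :
    normalFamily lam c n 2 = (inl (lam 2 0 * lam 2 1) : DualNumber ℂ) •
      (normalFamily lam c n 3 * (normalFamily lam c n 0 * normalFamily lam c n 1)).adjugate := rfl

theorem normalFamily_three (lam : Fin 3 → Fin 2 → ℂ) (c : ℂ) (n : Mat2) :
    normalFamily lam c n 3 = dual (c • 1) n := rfl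

theorem det_dual_smul_one {n : Mat2} (hn : n.trace = 0) :
    (dual (c • 1) n).det = inl (c ^ 2) := by
  rw [Matrix.trace_fin_two] at hn
  rw [Matrix.det_fin_two]
  ext
  · simp [dual, sq]
  · simp [dual]
    linear_combination c * hn

theorem trace_dual_smul_one_mul (n : Mat2) (A : DMat2) :
    (dual (c • 1) n * A).trace = inl (c * (red A).trace) +
      inr (c * (infPart A).trace + (n * red A).trace) := by
  rw [Matrix.trace_fin_two, Matrix.trace_fin_two, Matrix.trace_fin_two, Matrix.trace_fin_two]
  ext
  · simp [dual, Matrix.mul_apply, red_apply]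
    ring
  · simp [dual, Matrix.mul_apply, red_apply, infPart]
    ring

theorem trace_adjugate_fin_two {R : Type*} [CommRing R] (A : Matrix (Fin 2) (Fin 2) R) :
    A.adjugate.trace = A.trace := by
  rw [Matrix.adjugate_fin_two, Matrix.trace_fin_two, Matrix.trace_fin_two]
  simp [add_comm]

/-- With X = T 3 T 0 T 1, the matrix T 2 is X⁻¹ written as an adjugate, the basic relation giving
(det X)⁻¹ = lam 2 0 * lam 2 1. In size two the adjugate keeps the trace, so only tr X needs to be
right, and the corner entry of T 0 is chosen for that. -/
theorem isDualQuadruple_normalFamily (h : IsRelativelyGenericNotGeneric lam c) {n : Mat2}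
    (ht : n.trace = 0) (hd : n.det = 0) (hn : n ≠ 0) :
    IsDualQuadruple lam c (normalFamily lam c n) := by
  have hc := h.scalar_ne_zero
  have hb := h.basic
  rw [Fin.prod_univ_three] at hb
  set T := normalFamily lam c n with hT
  have ht0 : (T 0).trace = inl (lam 0 0) + inl (lam 0 1) := by
    rw [Matrix.trace_fin_two]
    ext <;> simp [hT, normalFamily, dual, normalFst]
  have hd0 : (T 0).det = inl (lam 0 0) * inl (lam 0 1) := by
    rw [Matrix.det_fin_two]
    ext <;> simp [hT, normalFamily, dual, normalFst]
  have ht1 : (T 1).trace = inl (lam 1 0) + inl (lam 1 1) := by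
    rw [Matrix.trace_fin_two]
    ext <;> simp [hT, normalFamily, dual, normalSnd]
  have hd1 : (T 1).det = inl (lam 1 0) * inl (lam 1 1) := by
    rw [Matrix.det_fin_two]
    ext <;> simp [hT, normalFamily, dual, normalSnd]
  have hd3 : (T 3).det = inl (c ^ 2) := det_dual_smul_one ht
  have hX : (T 3 * (T 0 * T 1)).det = inl (c ^ 2 * (lam 0 0 * lam 0 1 * (lam 1 0 * lam 1 1))) := by
    rw [Matrix.det_mul, Matrix.det_mul, hd0, hd1, hd3]
    simp only [inl_mul]
  -- The ε-part of this trace is c tr(infPart(T 0 T 1)) + tr(n N₀ N₁); the factor −c⁻¹ in the ε-part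
  -- of the corner entry cancels it.
  have hXt : (T 3 * (T 0 * T 1)).trace =
      inl ((lam 2 0 + lam 2 1) * c ^ 2 * (lam 0 0 * lam 0 1) * (lam 1 0 * lam 1 1)) := by
    rw [hT, normalFamily_three, trace_dual_smul_one_mul]
    have h1 : red (normalFamily lam c n 0 * normalFamily lam c n 1) =
        normalFst lam c * normalSnd lam := by
      rw [map_mul]
      simp [normalFamily]
    rw [h1, infPart_mul]
    ext
    · simp [normalFst, normalSnd, Matrix.trace_fin_two]
      ring
    · have h2 : red (normalFamily lam c n 0) * infPart (normalFamily lam c n 1) = 0 := by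
        simp [normalFamily]
      have h3 : (infPart (normalFamily lam c n 0) * red (normalFamily lam c n 1)).trace =
          -(c⁻¹ * (n * (normalFst lam c * normalSnd lam)).trace) := by
        simp [normalFamily]
        simp [Matrix.trace_fin_two, Matrix.mul_apply, normalSnd, Matrix.single_apply]
      rw [h2, zero_add, h3]
      simp [hc]
  have h2 : T 2 = (inl (lam 2 0 * lam 2 1) : DualNumber ℂ) • (T 3 * (T 0 * T 1)).adjugate :=
    normalFamily_two lam c n
  refine ⟨fun j => ?_, fun j => ?_, ?_, ?_, ?_, ?_, ?_⟩
  · fin_cases j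
    · exact ht0
    · exact ht1
    · change (T 2).trace = inl (lam 2 0) + inl (lam 2 1)
      rw [h2, Matrix.trace_smul, trace_adjugate_fin_two, hXt, smul_eq_mul, ← inl_mul, ← inl_add]
      congr 1
      linear_combination (lam 2 0 + lam 2 1) * hb
  · fin_cases j
    · exact hd0
    · exact hd1
    · change (T 2).det = inl (lam 2 0) * inl (lam 2 1)
      rw [h2, Matrix.det_smul, Matrix.det_adjugate, hX, Fintype.card_fin, show 2 - 1 = 1 from rfl,
        pow_one, inl_pow, ← inl_mul, ← inl_mul]
      congr 1
      linear_combination lam 2 0 * lam 2 1 * hb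
  · simp [hT, normalFamily_three]
  · simpa [hT, normalFamily_three] using ht
  · simpa [hT, normalFamily_three] using hd
  · simpa [hT, normalFamily_three] using hn
  · have h3 : T 3 * (T 0 * T 1) * T 2 = 1 := by
      rw [h2, mul_smul_comm, Matrix.mul_adjugate, hX, smul_smul, ← inl_mul]
      have : lam 2 0 * lam 2 1 * (c ^ 2 * (lam 0 0 * lam 0 1 * (lam 1 0 * lam 1 1))) = 1 := by
        linear_combination hb
      rw [this, inl_one, one_smul]
    rw [mul_assoc, mul_assoc] at h3
    have h4 := mul_eq_one_comm.1 h3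
    simpa only [mul_assoc] using h4

/-- The prescribed trace of B 2, a multiple of the adjugate of B 3 B 0 B 1, is one linear equation
over ℂ[ε] for the unknown y; its constant part and its ε-part determine both components of y. -/
theorem IsDualQuadruple.eq_normalFamily (h : IsRelativelyGenericNotGeneric lam c)
    {B : Fin 4 → DMat2} (hB : IsDualQuadruple lam c B) {y : DualNumber ℂ}
    (h0 : B 0 = !![inl (lam 0 0), y; 0, inl (lam 0 1)])
    (h1 : B 1 = !![0, -(inl (lam 1 0) * inl (lam 1 1)); 1, inl (lam 1 0) + inl (lam 1 1)]) :
    B = normalFamily lam c (infPart (B 3)) := by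
  have hc := h.scalar_ne_zero
  have h3 : B 3 = dual (c • 1) (infPart (B 3)) := by
    rw [← hB.red_last, dual_red_infPart]
  have hX : B 3 * (B 0 * B 1) * B 2 = 1 := by
    rw [mul_assoc, mul_eq_one_comm]
    exact hB.prod_eq
  have hdet : (B 3 * (B 0 * B 1)).det * (B 2).det = 1 := by
    rw [← Matrix.det_mul, hX, Matrix.det_one]
  have h2 : B 2 = (B 2).det • (B 3 * (B 0 * B 1)).adjugate := by
    calc B 2 = ((B 3 * (B 0 * B 1)).det * (B 2).det) • B 2 := by rw [hdet, one_smul]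
      _ = (B 2).det • ((B 3 * (B 0 * B 1)).adjugate * (B 3 * (B 0 * B 1)) * B 2) := by
        rw [Matrix.adjugate_mul, smul_mul_assoc, one_mul, smul_smul, mul_comm]
      _ = _ := by rw [mul_assoc, hX, mul_one]
  have htX : (B 3 * (B 0 * B 1)).trace =
      inl ((lam 2 0 + lam 2 1) * c ^ 2 * (lam 0 0 * lam 0 1) * (lam 1 0 * lam 1 1)) := by
    have e1 : (B 2).trace = (B 2).det * (B 3 * (B 0 * B 1)).trace := by
      conv_lhs => rw [h2]
      rw [Matrix.trace_smul, trace_adjugate_fin_two, smul_eq_mul]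
    have e2 : (B 3 * (B 0 * B 1)).trace = (B 3 * (B 0 * B 1)).det * (B 2).trace := by
      rw [e1, ← mul_assoc (Matrix.det _), hdet, one_mul]
    have e3 : (B 3).det = inl (c ^ 2) := by
      rw [h3, det_dual_smul_one hB.trace_inf]
    rw [e2, Matrix.det_mul, Matrix.det_mul, e3]
    have d0 : (B 0).det = _ := hB.det_eq 0
    have d1 : (B 1).det = _ := hB.det_eq 1
    have t2 : (B 2).trace = _ := hB.trace_eq 2
    rw [d0, d1, t2]
    simp only [← inl_mul, ← inl_add]
    congr 1
    ring
  rw [h3, trace_dual_smul_one_mul] at htX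
  have hfst := congrArg fst htX
  have hsnd := congrArg snd htX
  simp only [fst_add, snd_add, fst_inl, fst_inr, snd_inl, snd_inr, add_zero, zero_add] at hfst hsnd
  have hy : y.fst = (lam 2 0 + lam 2 1) * c * (lam 0 0 * lam 0 1) * (lam 1 0 * lam 1 1) -
      lam 0 1 * (lam 1 0 + lam 1 1) := by
    have e : (red (B 0 * B 1)).trace = y.fst + lam 0 1 * (lam 1 0 + lam 1 1) := by
      simp [Matrix.trace_fin_two, red_apply, h0, h1]
    rw [e] at hfst
    refine mul_left_cancel₀ hc ?_
    linear_combination hfst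
  have hr0 : red (B 0) = normalFst lam c := by
    ext i j
    fin_cases i <;> fin_cases j <;> simp [h0, red_apply, normalFst, hy]
  have hr1 : red (B 1) = normalSnd lam := by
    ext i j
    fin_cases i <;> fin_cases j <;> simp [h1, red_apply, normalSnd]
  have hy' : y.snd = -(c⁻¹ * (infPart (B 3) * (normalFst lam c * normalSnd lam)).trace) := by
    have e : (infPart (B 0 * B 1)).trace = y.snd := by
      simp [Matrix.trace_fin_two, infPart, h0, h1]
    rw [e, map_mul, hr0, hr1] at hsnd
    refine mul_left_cancel₀ hc ?_
    rw [mul_neg, mul_inv_cancel_left₀ hc]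
    linear_combination hsnd
  have k0 : B 0 = normalFamily lam c (infPart (B 3)) 0 := by
    rw [← dual_red_infPart (B 0), hr0]
    change _ = dual _ _
    congr 1
    rw [← hy']
    ext i j
    fin_cases i <;> fin_cases j <;> simp [infPart, h0]
  have k1 : B 1 = normalFamily lam c (infPart (B 3)) 1 := by
    have e : infPart (B 1) = 0 := by
      ext i j
      fin_cases i <;> fin_cases j <;> simp [infPart, h1]
    rw [← dual_red_infPart (B 1), hr1, e]
    rfl
  have k3 : B 3 = normalFamily lam c (infPart (B 3)) 3 := h3
  have d2 : (B 2).det = _ := hB.det_eq 2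
  funext j
  fin_cases j
  · exact k0
  · exact k1
  · change B 2 = normalFamily lam c (infPart (B 3)) 2
    rw [normalFamily_two, ← k0, ← k1, ← k3, inl_mul]
    conv_lhs => rw [h2, d2]
  · exact k3

/-- Every quadruple over the dual numbers is conjugate to its normal form. -/
theorem IsDualQuadruple.exists_conj_eq_normalFamily (hdistinct : lam 0 0 ≠ lam 0 1)
    (h : IsRelativelyGenericNotGeneric lam c) {A : Fin 4 → DMat2}
    (hA : IsDualQuadruple lam c A) :
    ∃ (P : DMat2ˣ) (n : Mat2), n.trace = 0 ∧ n.det = 0 ∧ n ≠ 0 ∧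
      ∀ j, A j = (P : DMat2) * normalFamily lam c n j * ((P⁻¹ : DMat2ˣ) : DMat2) := by
  have hred := hA.hasData_red
  obtain ⟨i, k, hk⟩ := exists_sub_ne_zero hdistinct (hred.trace_eq 0)
  set u : Fin 2 → DualNumber ℂ := fun k => A 0 k i - if k = i then inl (lam 0 1) else 0 with hu
  obtain ⟨e0, e1⟩ := mul_cyclicMatrix (hA.trace_eq 0) (hA.det_eq 0) (hA.trace_eq 1) (hA.det_eq 1)
    i hu
  set U : DMat2 := Matrix.of fun k => ![u k, (A 1).mulVec u k] with hU
  change A 0 * U = U * _ at e0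
  change A 1 * U = U * _ at e1
  let v : Fin 2 → ℂ := fun k => (u k).fst
  have hv : v ≠ 0 := by
    intro h0
    refine hk ?_
    refine Eq.trans ?_ (congrFun h0 k)
    by_cases hki : k = i <;> simp [v, hu, hki, red_apply]
  have hcol : ∀ k, red U k 0 = v k := fun k => rfl
  have hcol' : ∀ k, red U k 1 = (red (A 1)).mulVec v k := by
    intro k
    simp [red_apply, hU, Matrix.mulVec, dotProduct, v]
  have h0v : (red (A 0)).mulVec v = lam 0 0 • v := by
    funext k
    have := congrArg (fun B => red B k 0) e0
    simpa [Matrix.mul_apply, Matrix.mulVec, dotProduct, hcol, mul_comm, red_apply, v, hU]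
      using this
  -- If u and A 1 u were dependent modulo ε, the reduction of u would be a common eigenvector of the
  -- first two matrices.
  have hUdet : (red U).det ≠ 0 := by
    intro hdet
    obtain ⟨w, hw, hUw⟩ := Matrix.exists_mulVec_eq_zero_iff.2 hdet
    have hlin : ∀ k, v k * w 0 + (red (A 1)).mulVec v k * w 1 = 0 := by
      intro k
      simpa [Matrix.mulVec, dotProduct, Fin.sum_univ_two, hcol, hcol'] using congrFun hUw k
    have hw1 : w 1 ≠ 0 := by
      intro hw1
      have hw0 : w 0 = 0 := by
        by_contra hw0
        refine hv (funext fun k => ?_)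
        simpa [hw1, hw0] using hlin k
      exact hw (funext fun k => by fin_cases k <;> assumption)
    refine hred.false_of_eigenvector h hv h0v (ν := -(w 0 / w 1)) (funext fun k => ?_)
    simp only [Pi.smul_apply, smul_eq_mul]
    field_simp
    linear_combination hlin k
  obtain ⟨P, hP⟩ := isUnit_of_det_red_ne_zero hUdet
  rw [← hP] at e0 e1
  have hB := hA.conj P
  have b0 := congrArg (fun B => ((P⁻¹ : DMat2ˣ) : DMat2) * B) e0
  have b1 := congrArg (fun B => ((P⁻¹ : DMat2ˣ) : DMat2) * B) e1
  simp only [← mul_assoc, Units.inv_mul, one_mul] at b0 b1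
  have hn := hB.eq_normalFamily h b0 b1
  refine ⟨P, infPart (((P⁻¹ : DMat2ˣ) : DMat2) * A 3 * (P : DMat2)), hB.trace_inf, hB.det_inf,
    hB.inf_ne_zero, fun j => ?_⟩
  rw [← congrFun hn j]
  simp [mul_assoc]

end NormalForm

end DeligneSimpson

namespace DeligneSimpson

open TrivSqZeroExt

/-! ### The stratum in terms of dual numbers -/

section Stratum

variable {lam : Fin 3 → Fin 2 → ℂ} {c : ℂ}

theorem exists_eq_conj_single {n : Mat2} (ht : n.trace = 0) (hd : n.det = 0) (hn : n ≠ 0) :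
    ∃ g : Mat2ˣ, n = (g : Mat2) * Matrix.single 0 1 1 * ((g⁻¹ : Mat2ˣ) : Mat2) := by
  rw [Matrix.trace_fin_two] at ht
  rw [Matrix.det_fin_two] at hd
  suffices h : ∃ U : Mat2, IsUnit U ∧ n * U = U * Matrix.single 0 1 1 by
    obtain ⟨_, ⟨g, rfl⟩, h⟩ := h
    exact ⟨g, by rw [Units.eq_mul_inv_iff_mul_eq, h]⟩
  have h11 : n 1 1 = -n 0 0 := by linear_combination ht
  rw [h11] at hd
  by_cases h10 : n 1 0 = 0
  · have h00 : n 0 0 = 0 := by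
      rw [h10] at hd
      simpa using hd
    have h01 : n 0 1 ≠ 0 := by
      intro h01
      refine hn ?_
      ext i j
      fin_cases i <;> fin_cases j <;> simp [h00, h01, h10, h11]
    refine ⟨!![n 0 1, 0; 0, 1], ?_, ?_⟩
    · rw [Matrix.isUnit_iff_isUnit_det, Matrix.det_fin_two]
      simpa using h01
    · ext i j
      fin_cases i <;> fin_cases j <;>
        simp [Matrix.mul_apply, Matrix.single_apply, h00, h10, h11]
  · refine ⟨!![n 0 0, 1; n 1 0, 0], ?_, ?_⟩
    · rw [Matrix.isUnit_iff_isUnit_det, Matrix.det_fin_two]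
      simpa using h10
    · ext i j
      fin_cases i <;> fin_cases j <;>
        simp [Matrix.mul_apply, Matrix.single_apply, h11]
      · linear_combination -hd
      · ring

/-- Quadratic equations are invariant under conjugation. -/
theorem quadratic_of_semiconjBy {R : Type*} [Ring R] [Algebra ℂ R] {A B : R} {U : Rˣ}
    (h : SemiconjBy (U : R) A B) {s d : ℂ} (hA : A * A - s • A + d • (1 : R) = 0) :
    B * B - s • B + d • (1 : R) = 0 := by
  have hB : B = U * A * (U⁻¹ : Rˣ) := by
    rw [Units.eq_mul_inv_iff_mul_eq]
    exact h.eq.symm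
  have : B * B - s • B + d • (1 : R) = U * (A * A - s • A + d • (1 : R)) * (U⁻¹ : Rˣ) := by
    rw [hB]
    simp only [mul_add, mul_sub, add_mul, sub_mul, mul_smul_comm, smul_mul_assoc, mul_one,
      Units.mul_inv, mul_assoc, Units.inv_mul_cancel_left]
  rw [this, hA, mul_zero, zero_mul]

theorem diagonal_quadratic (l : Fin 2 → ℂ) :
    Matrix.diagonal (Sum.elim l l) * Matrix.diagonal (Sum.elim l l) -
      (l 0 + l 1) • Matrix.diagonal (Sum.elim l l) + (l 0 * l 1) • (1 : Mat4) = 0 := by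
  ext i j
  by_cases hij : i = j
  · subst hij
    rcases i with i | i <;> fin_cases i <;> simp <;> ring
  · simp [hij]

/-- Subtracting Cayley–Hamilton from the quadratic equation leaves (tr A − a − b) A = (det A − ab) ·
1. Its ε-part is a linear relation between `red A` and 1; as a ≠ b, `red A` is not scalar and both
coefficients vanish. -/
theorem trace_det_of_quadratic {A : DMat2} {a b : ℂ} (hab : a ≠ b)
    (ht : (red A).trace = a + b) (hd : (red A).det = a * b)
    (hA : A * A - (a + b) • A + (a * b) • (1 : DMat2) = 0) :
    A.trace = inl a + inl b ∧ A.det = inl a * inl b := by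
  have ht0 : A.trace.fst = a + b := by
    simpa [Matrix.trace_fin_two, red_apply] using ht
  have hd0 : A.det.fst = a * b := by rw [fst_det, hd]
  have key : ∀ i j, (A.trace - inl (a + b)) * A i j =
      (A.det - inl (a * b)) * (1 : DMat2) i j := by
    intro i j
    have hij := congrFun (congrFun hA i) j
    have e1 : ∀ (z : ℂ) (x : DualNumber ℂ), z • x = inl z * x := by
      intro z x
      ext <;> simp
    simp only [Matrix.add_apply, Matrix.sub_apply, Matrix.smul_apply, Matrix.zero_apply,
      Matrix.mul_apply, Fin.sum_univ_two, e1] at hij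
    rw [Matrix.trace_fin_two, Matrix.det_fin_two]
    fin_cases i <;> fin_cases j <;> simp at hij ⊢ <;> linear_combination hij
  have key' : ∀ i j, A.trace.snd * red A i j = A.det.snd * (1 : Mat2) i j := by
    intro i j
    have := congrArg snd (key i j)
    rw [DualNumber.snd_mul, DualNumber.snd_mul] at this
    simp only [fst_sub, snd_sub, fst_inl, snd_inl, ht0, hd0, sub_self, zero_mul, sub_zero,
      zero_add] at this
    rw [red_apply, this]
    by_cases hij : i = j <;> simp [hij, Matrix.one_apply]
  have hts : A.trace.snd = 0 := by
    by_contra hne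
    have k01 := key' 0 1
    have k10 := key' 1 0
    have k00 := key' 0 0
    have k11 := key' 1 1
    simp only [Matrix.one_apply_eq, Matrix.one_apply_ne (show (0 : Fin 2) ≠ 1 by decide),
      Matrix.one_apply_ne (show (1 : Fin 2) ≠ 0 by decide), mul_one, mul_zero] at k01 k10 k00 k11
    have h01 : red A 0 1 = 0 := (mul_eq_zero.1 k01).resolve_left hne
    have h00 : red A 0 0 = red A 1 1 := mul_left_cancel₀ hne (k00.trans k11.symm)
    rw [Matrix.trace_fin_two, h00] at ht
    rw [Matrix.det_fin_two, h01, h00] at hd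
    have : (a - b) ^ 2 = 0 := by linear_combination 4 * hd - (2 * red A 1 1 + a + b) * ht
    exact hab (sub_eq_zero.1 (pow_eq_zero_iff (two_ne_zero)|>.1 this))
  have hds : A.det.snd = 0 := by
    have := key' 0 0
    rw [hts] at this
    simpa using this.symm
  constructor
  · ext <;> simp [ht0, hts]
  · ext <;> simp [hd0, hds]

theorem fromBlocks_smul_one_zero (c : ℂ) (n : Mat2) :
    Matrix.fromBlocks (c • 1) n 0 (c • 1) = c • (1 : Mat4) + Matrix.fromBlocks 0 n 0 0 := by
  rw [← Matrix.fromBlocks_one, Matrix.fromBlocks_smul, Matrix.fromBlocks_add]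
  simp

/-- The matrix unit E satisfies E Y E ∈ ℂ E for every Y. This rank-one property survives conjugation
and makes the 2 × 2 minor of n vanish. -/
theorem ne_zero_and_det_eq_zero_of_isConj {n : Mat2} (h : IsConj
    (c • (1 : Mat4) + Matrix.single (Sum.inl 0) (Sum.inl 1) 1)
    (Matrix.fromBlocks (c • 1) n 0 (c • 1))) : n ≠ 0 ∧ n.det = 0 := by
  obtain ⟨U, hU⟩ := h
  set E : Mat4 := Matrix.single (Sum.inl 0) (Sum.inl 1) 1 with hE
  set X : Mat4 := Matrix.fromBlocks 0 n 0 0 with hX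
  have hUX : (U : Mat4) * E = X * U := by
    have := hU.eq
    rw [fromBlocks_smul_one_zero, mul_add, add_mul] at this
    simpa using this
  have hXE : X = U * E * ((U⁻¹ : Mat4ˣ) : Mat4) := by
    rw [Units.eq_mul_inv_iff_mul_eq, hUX]
  constructor
  · rintro rfl
    have h0 : X = 0 := by
      rw [hX]
      exact Matrix.fromBlocks_zero
    rw [h0, zero_mul] at hUX
    have hE0 : E = 0 := by
      have := congrArg (fun B => ((U⁻¹ : Mat4ˣ) : Mat4) * B) hUX
      simpa using this
    have := congrFun (congrFun hE0 (Sum.inl 0)) (Sum.inl 1)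
    simp [hE] at this
  · have hEYE : ∀ Y : Mat4, E * Y * E = Y (Sum.inl 1) (Sum.inl 0) • E := by
      intro Y
      ext i j
      rcases i with i | i <;> rcases j with j | j <;> fin_cases i <;> fin_cases j <;>
        simp [hE, Matrix.mul_apply, Matrix.single_apply]
    have hXYX : ∀ Y : Mat4, ∃ s : ℂ, X * Y * X = s • X := by
      intro Y
      refine ⟨(((U⁻¹ : Mat4ˣ) : Mat4) * Y * U) (Sum.inl 1) (Sum.inl 0), ?_⟩
      calc X * Y * X = U * (E * (((U⁻¹ : Mat4ˣ) : Mat4) * Y * U) * E) * ((U⁻¹ : Mat4ˣ) : Mat4) := by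
            rw [hXE]
            simp only [mul_assoc]
        _ = _ := by
            rw [hEYE, hXE]
            simp only [mul_smul_comm, smul_mul_assoc]
    have hn : ∀ i j, ∃ s : ℂ, ∀ k l, n k i * n j l = s * n k l := by
      intro i j
      -- Only the lower left block of Y enters X Y X, whose upper right block is then n e_ij n.
      obtain ⟨s, hs⟩ := hXYX (Matrix.fromBlocks 0 0 (Matrix.single i j 1) 0)
      refine ⟨s, fun k l => ?_⟩
      have := congrFun (congrFun hs (Sum.inl k)) (Sum.inr l)
      simpa [hX, Matrix.fromBlocks_multiply, Matrix.mul_apply, Matrix.single_apply, ite_and]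
        using this
    obtain ⟨s, hs⟩ := hn 0 1
    rw [Matrix.det_fin_two]
    have s00 := hs 0 0
    have s01 := hs 0 1
    have s10 := hs 1 0
    have s11 := hs 1 1
    grind

theorem isConj_of_nilpotent {n : Mat2} (ht : n.trace = 0) (hd : n.det = 0) (hn : n ≠ 0) :
    IsConj (c • (1 : Mat4) + Matrix.single (Sum.inl 0) (Sum.inl 1) 1)
      (Matrix.fromBlocks (c • 1) n 0 (c • 1)) := by
  obtain ⟨g, hg⟩ := exists_eq_conj_single ht hd hn
  -- The permutation exchanging `inl 1` and `inr 1` moves the Jordan entry into the upper right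
  -- block; afterwards diag(g, g) conjugates that block to n.
  let U : Mat4 := Matrix.of fun i j => if i = Equiv.swap (Sum.inl 1) (Sum.inr 1) j then 1 else 0
  have hUU : U * U = 1 := by
    ext i j
    rcases i with i | i <;> rcases j with j | j <;> fin_cases i <;> fin_cases j <;>
      simp [U, Matrix.mul_apply, Equiv.swap_apply_def]
  let u : Mat4ˣ := ⟨U, U, hUU, hUU⟩
  let V : Mat4ˣ := Units.map (blockHom : DMat2 →* Mat4)
    (Units.map ((Algebra.ofId ℂ (DualNumber ℂ)).mapMatrix : Mat2 →ₐ[ℂ] DMat2) g)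
  have hV : (V : Mat4) = Matrix.fromBlocks (g : Mat2) 0 0 g := by
    change blockHom ((Algebra.ofId ℂ (DualNumber ℂ)).mapMatrix (g : Mat2)) = _
    rw [blockHom_apply]
    congr 1
  have h1 : (u : Mat4) * Matrix.single (Sum.inl 0) (Sum.inl 1) 1 =
      Matrix.fromBlocks 0 (Matrix.single 0 1 1) 0 0 * (u : Mat4) := by
    change U * _ = _ * U
    ext i j
    rcases i with i | i <;> rcases j with j | j <;> fin_cases i <;> fin_cases j <;>
      simp [U, Matrix.mul_apply, Matrix.single_apply, Equiv.swap_apply_def]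
  have h2 : (V : Mat4) * Matrix.fromBlocks 0 (Matrix.single 0 1 1) 0 0 =
      Matrix.fromBlocks 0 n 0 0 * (V : Mat4) := by
    rw [hV, Matrix.fromBlocks_multiply, Matrix.fromBlocks_multiply, hg]
    simp [mul_assoc]
  refine ⟨V * u, ?_⟩
  change ((V * u : Mat4ˣ) : Mat4) * _ = _ * ((V * u : Mat4ˣ) : Mat4)
  rw [fromBlocks_smul_one_zero, mul_add, add_mul, Units.val_mul,
    mul_assoc _ _ (Matrix.single _ _ _), h1, ← mul_assoc _ _ (u : Mat4), h2, mul_assoc _ _ (u : Mat4)]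
  simp

theorem trace_det_of_isConj_diagonal {N : Mat2} {l : Fin 2 → ℂ}
    (h : IsConj (Matrix.diagonal l) N) : N.trace = l 0 + l 1 ∧ N.det = l 0 * l 1 := by
  obtain ⟨U, hU⟩ := h
  have hN : Matrix.diagonal l = ((U⁻¹ : Mat2ˣ) : Mat2) * N * U := by
    rw [mul_assoc, ← hU.eq, Units.inv_mul_cancel_left]
  rw [← trace_units_conj U N, ← det_units_conj U N, ← hN]
  simp

/-- Irreducibility is automatic, an invariant line being spanned by a common eigenvector; hence
`IsDualQuadruple` need not require it. -/
theorem HasData.isIrreducibleQuadruple (h : IsRelativelyGenericNotGeneric lam c)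
    {N : Fin 4 → Mat2} (hN : HasData lam c N) : IsIrreducibleQuadruple N := by
  intro p hp
  by_contra! hne
  have h1 : Module.finrank ℂ p < 2 := by
    simpa using Submodule.finrank_lt hne.2
  have h2 : Module.finrank ℂ p ≠ 0 := fun h0 => hne.1 (Submodule.finrank_eq_zero.1 h0)
  obtain ⟨⟨v, hvp⟩, hv, hspan⟩ := finrank_eq_one_iff'.1 (show Module.finrank ℂ p = 1 by omega)
  have key : ∀ j, ∃ μ : ℂ, (N j).mulVec v = μ • v := by
    intro j
    obtain ⟨μ, hμ⟩ := hspan ⟨_, hp j v hvp⟩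
    exact ⟨μ, (congrArg Subtype.val hμ).symm⟩
  obtain ⟨μ, hμ⟩ := key 0
  obtain ⟨ν, hν⟩ := key 1
  exact hN.false_of_eigenvector h (fun h0 => hv (Subtype.ext h0)) hμ hν

theorem isConj_units_conj {R : Type*} [Monoid R] (U : Rˣ) (A : R) :
    IsConj A (U * A * (U⁻¹ : Rˣ)) :=
  ⟨U, by simp [SemiconjBy, mul_assoc]⟩

/-- The first three classes impose quadratic equations, which make trace and determinant constant
over ℂ[ε]; conversely such matrices are diagonalised over ℂ[ε]. For the fourth class the point is
that n is non-zero and nilpotent. -/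
theorem mem_stratumW_iff (hdistinct : ∀ j, lam j 0 ≠ lam j 1)
    (h : IsRelativelyGenericNotGeneric lam c) {M : Fin 4 → Mat4} :
    M ∈ stratumW lam c ↔ ∃ A, IsDualQuadruple lam c A ∧
      ∃ G : Mat4ˣ, ∀ j, M j = (G : Mat4) * blockHom (A j) * ((G⁻¹ : Mat4ˣ) : Mat4) := by
  constructor
  · rintro ⟨⟨hconj, hprod⟩, N, ⟨hNconj, hN3, hNprod, -⟩, R, g, hM⟩
    have hM' : ∀ j, M j = (g : Mat4) * blockHom (dual (N j) (R j)) * ((g⁻¹ : Mat4ˣ) : Mat4) := by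
      intro j
      rw [hM, blockHom_dual]
    have hconj' : ∀ j, IsConj (jordanForm lam c j) (blockHom (dual (N j) (R j))) := by
      intro j
      refine (hconj j).trans (IsConj.symm ?_)
      rw [hM' j]
      exact isConj_units_conj _ _
    have hAprod : dual (N 0) (R 0) * dual (N 1) (R 1) * dual (N 2) (R 2) * dual (N 3) (R 3) = 1 := by
      apply blockHom_injective
      rw [map_one]
      rw [hM' 0, hM' 1, hM' 2, hM' 3] at hprod
      have := congrArg (fun B => ((g⁻¹ : Mat4ˣ) : Mat4) * B * g) hprod
      simpa [mul_assoc] using this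
    have htd : ∀ j : Fin 3, (dual (N j.castSucc) (R j.castSucc)).trace =
        inl (lam j 0) + inl (lam j 1) ∧ (dual (N j.castSucc) (R j.castSucc)).det =
        inl (lam j 0) * inl (lam j 1) := by
      intro j
      obtain ⟨ht, hd⟩ := trace_det_of_isConj_diagonal (hNconj j)
      refine trace_det_of_quadratic (hdistinct j) (by rw [red_dual, ht]) (by rw [red_dual, hd]) ?_
      obtain ⟨U, hU⟩ := hconj' j.castSucc
      apply blockHom_injective
      rw [map_add, map_sub, map_mul, map_smul, map_smul, map_one, map_zero]
      refine quadratic_of_semiconjBy hU ?_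
      fin_cases j <;> exact diagonal_quadratic _
    have h3 := hconj' 3
    rw [blockHom_dual, hN3] at h3
    obtain ⟨hne, hdet⟩ := ne_zero_and_det_eq_zero_of_isConj h3
    refine ⟨fun j => dual (N j) (R j), ⟨fun j => (htd j).1, fun j => (htd j).2, ?_, ?_, ?_, ?_,
      hAprod⟩, g, hM'⟩
    · rw [red_dual, hN3]
    · rw [infPart_dual]
      -- The trace of n vanishes by the ε-part of det(A 0 A 1 A 2 A 3) = 1: the first three
      -- determinants are constant, and det A 3 = c² + ε c tr n.
      have hd := congrArg Matrix.det hAprod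
      have d0 := (htd 0).2
      have d1 := (htd 1).2
      have d2 := (htd 2).2
      simp only [Fin.isValue, Fin.castSucc_zero, Fin.castSucc_one] at d0 d1
      change (dual (N 2) (R 2)).det = _ at d2
      rw [Matrix.det_mul, Matrix.det_mul, Matrix.det_mul, d0, d1, d2, Matrix.det_one] at hd
      have hd3 : (dual (N 3) (R 3)).det = inl (c ^ 2) + inr (c * (R 3).trace) := by
        rw [hN3, Matrix.det_fin_two, Matrix.trace_fin_two]
        ext <;> simp [dual] <;> ring
      rw [hd3] at hd
      simp only [← inl_mul] at hd
      have hs := congrArg snd hd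
      have hb := h.basic
      rw [Fin.prod_univ_three] at hb
      simp only [DualNumber.snd_mul, fst_inl, snd_add, snd_inl, snd_inr, zero_add, zero_mul,
        add_zero, snd_one] at hs
      have : (R 3).trace * (lam 0 0 * lam 0 1 * (lam 1 0 * lam 1 1) * (lam 2 0 * lam 2 1) * c ^ 2)
          = 0 := by
        linear_combination c * hs
      rwa [hb, mul_one] at this
    · rwa [infPart_dual]
    · rwa [infPart_dual]
  · rintro ⟨A, hA, G, hM⟩
    have hred := hA.hasData_red
    have hdiag : ∀ j : Fin 3, ∃ P : DMat2ˣ, A j.castSucc = (P : DMat2) *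
        Matrix.diagonal ![inl (lam j 0), inl (lam j 1)] * ((P⁻¹ : DMat2ˣ) : DMat2) :=
      fun j => exists_eq_conj_diagonal (hdistinct j) (hA.trace_eq j) (hA.det_eq j)
    have hblock : ∀ j : Fin 3, IsConj (Matrix.diagonal (Sum.elim (lam j) (lam j)))
        (blockHom (A j.castSucc)) := by
      intro j
      obtain ⟨P, hP⟩ := hdiag j
      have hd : blockHom (Matrix.diagonal ![inl (lam j 0), inl (lam j 1)]) =
          Matrix.diagonal (Sum.elim (lam j) (lam j)) := by
        rw [blockHom_apply, ← Matrix.fromBlocks_diagonal]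
        congr 1
        · ext i k
          fin_cases i <;> fin_cases k <;> simp [red_apply]
        · ext i k
          fin_cases i <;> fin_cases k <;> simp [infPart]
        · ext i k
          fin_cases i <;> fin_cases k <;> simp [red_apply]
      rw [hP, map_mul, map_mul, hd]
      exact isConj_units_conj (Units.map (blockHom : DMat2 →* Mat4) P) _
    have hA3 : A 3 = dual (c • 1) (infPart (A 3)) := by
      rw [← hA.red_last, dual_red_infPart]
    refine ⟨⟨fun j => ?_, ?_⟩, fun j => red (A j), ⟨fun j => ?_, hA.red_last, hred.prod_eq,
      hred.isIrreducibleQuadruple h⟩, fun j => infPart (A j), G, fun j => hM j⟩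
    · rw [hM j]
      refine IsConj.trans ?_ (isConj_units_conj _ _)
      fin_cases j
      · exact hblock 0
      · exact hblock 1
      · exact hblock 2
      · change IsConj _ (blockHom (A 3))
        rw [hA3, blockHom_dual]
        exact isConj_of_nilpotent hA.trace_inf hA.det_inf hA.inf_ne_zero
    · rw [hM 0, hM 1, hM 2, hM 3]
      have := congrArg blockHom hA.prod_eq
      rw [map_mul, map_mul, map_mul, map_one] at this
      calc _ = (G : Mat4) * (blockHom (A 0) * blockHom (A 1) * blockHom (A 2) * blockHom (A 3)) *
            ((G⁻¹ : Mat4ˣ) : Mat4) := by simp [mul_assoc]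
        _ = 1 := by rw [this]; simp
    · obtain ⟨P, hP⟩ := hdiag j
      have hd : red (Matrix.diagonal ![inl (lam j 0), inl (lam j 1)]) =
          Matrix.diagonal (lam j) := by
        ext i k
        fin_cases i <;> fin_cases k <;> simp [red_apply]
      change IsConj _ (red (A j.castSucc))
      rw [hP, map_mul, map_mul, hd]
      exact isConj_units_conj (Units.map (red : DMat2 →* Mat2) P) _

end Stratum

end DeligneSimpson

namespace DeligneSimpson

open TrivSqZeroExt

/-! ### Families of quadruples -/

section Families

variable {lam : Fin 3 → Fin 2 → ℂ} {c : ℂ}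

theorem lift_units_conj {R α : Type*} [Ring R] [Algebra ℂ R] (U : Rˣ) (x : α → R)
    (p : FreeAlgebra ℂ α) :
    FreeAlgebra.lift ℂ (fun j => (U : R) * x j * (U⁻¹ : Rˣ)) p =
      U * FreeAlgebra.lift ℂ x p * (U⁻¹ : Rˣ) := by
  induction p using FreeAlgebra.induction with
  | grade0 r =>
    rw [AlgHom.commutes, AlgHom.commutes, ← Algebra.commutes, mul_assoc, Units.mul_inv, mul_one]
  | grade1 a => simp
  | mul p q hp hq =>
    rw [map_mul, hp, hq, map_mul]
    simp only [mul_assoc, Units.inv_mul_cancel_left]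
  | add p q hp hq => rw [map_add, hp, hq, map_add, mul_add, add_mul]

theorem lift_algHom {R S α : Type*} [Ring R] [Algebra ℂ R] [Ring S] [Algebra ℂ S] (f : R →ₐ[ℂ] S)
    (x : α → R) (p : FreeAlgebra ℂ α) :
    FreeAlgebra.lift ℂ (fun j => f (x j)) p = f (FreeAlgebra.lift ℂ x p) := by
  have : FreeAlgebra.lift ℂ (fun j => f (x j)) = f.comp (FreeAlgebra.lift ℂ x) := by
    ext j
    simp
  rw [this, AlgHom.comp_apply]

/-- The reductions of the matrices generate the algebra of all matrices. -/
theorem IsDualQuadruple.lift_red_surjective (hdistinct : lam 0 0 ≠ lam 0 1)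
    (h : IsRelativelyGenericNotGeneric lam c) {A : Fin 4 → DMat2}
    (hA : IsDualQuadruple lam c A) :
    Function.Surjective (FreeAlgebra.lift ℂ fun j => red (A j)) := by
  have hred := hA.hasData_red
  obtain ⟨P, hP⟩ := exists_eq_conj_diagonal hdistinct (hA.trace_eq 0) (hA.det_eq 0)
  let U : Mat2ˣ := Units.map (red : DMat2 →* Mat2) P
  have hUU : ((U⁻¹ : Mat2ˣ) : Mat2) = red ((P⁻¹ : DMat2ˣ) : DMat2) := rfl
  have hN0 : red (A 0) = (U : Mat2) * Matrix.diagonal (lam 0) * ((U⁻¹ : Mat2ˣ) : Mat2) := by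
    have hd : red (Matrix.diagonal ![inl (lam 0 0), inl (lam 0 1)]) = Matrix.diagonal (lam 0) := by
      ext i k
      fin_cases i <;> fin_cases k <;> simp [red_apply]
    have := congrArg red hP
    rw [map_mul, map_mul, hd] at this
    exact this
  let B : Fin 4 → Mat2 := fun j => ((U⁻¹ : Mat2ˣ) : Mat2) * red (A j) * U
  have hNB : ∀ j, red (A j) = (U : Mat2) * B j * ((U⁻¹ : Mat2ˣ) : Mat2) := by
    intro j
    simp [B, mul_assoc]
  have hB0 : B 0 = Matrix.diagonal (lam 0) := by
    simp [B, hN0, mul_assoc]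
  have hUcol : ∀ i, (U : Mat2).mulVec (Pi.single i 1) ≠ 0 := by
    intro i h0
    have := congrArg (fun v => ((U⁻¹ : Mat2ˣ) : Mat2).mulVec v) h0
    simp only [Matrix.mulVec_mulVec, Units.inv_mul, Matrix.one_mulVec, Matrix.mulVec_zero] at this
    have := congrFun this i
    simp at this
  have hvec : ∀ (j : Fin 4) (i : Fin 2) (μ : ℂ), (B j).mulVec (Pi.single i 1) =
      μ • Pi.single i 1 → (red (A j)).mulVec ((U : Mat2).mulVec (Pi.single i 1)) =
        μ • (U : Mat2).mulVec (Pi.single i 1) := by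
    intro j i μ hμ
    rw [hNB, Matrix.mulVec_mulVec, mul_assoc, Units.inv_mul, mul_one, ← Matrix.mulVec_mulVec, hμ,
      Matrix.mulVec_smul]
  -- A zero off-diagonal entry would make a basis vector a common eigenvector. Since B 0 is diagonal
  -- with distinct entries and so yields the diagonal matrix units, the non-zero entries of B 1
  -- yield the others.
  have hoff : ∀ i k, i ≠ k → B 1 k i ≠ 0 := by
    intro i k hik h0
    refine hred.false_of_eigenvector h (hUcol i) (hvec 0 i (lam 0 i) ?_) (hvec 1 i (B 1 i i) ?_)
    · rw [hB0]
      ext l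
      by_cases hl : l = i <;> simp [hl]
    · ext l
      by_cases hl : l = i
      · subst hl
        simp
      · have : l = k := by omega
        subst this
        simp [h0, hl]
  let S := (FreeAlgebra.lift ℂ B).range
  have hBS : ∀ j, B j ∈ S := fun j => ⟨FreeAlgebra.ι ℂ j, by simp⟩
  have hdiag : ∀ i, Matrix.single i i (1 : ℂ) ∈ S := by
    intro i
    fin_cases i
    · have : Matrix.single 0 0 (1 : ℂ) = (lam 0 0 - lam 0 1)⁻¹ • (B 0 - lam 0 1 • (1 : Mat2)) := by
        rw [hB0]
        ext k l
        fin_cases k <;> fin_cases l <;> simp [sub_ne_zero.2 hdistinct]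
      change Matrix.single 0 0 (1 : ℂ) ∈ S
      rw [this]
      exact S.smul_mem (S.sub_mem (hBS 0) (S.smul_mem S.one_mem _)) _
    · have : Matrix.single 1 1 (1 : ℂ) = (lam 0 1 - lam 0 0)⁻¹ • (B 0 - lam 0 0 • (1 : Mat2)) := by
        rw [hB0]
        ext k l
        fin_cases k <;> fin_cases l <;> simp [sub_ne_zero.2 hdistinct.symm]
      change Matrix.single 1 1 (1 : ℂ) ∈ S
      rw [this]
      exact S.smul_mem (S.sub_mem (hBS 0) (S.smul_mem S.one_mem _)) _
  have hsingle : ∀ k i, Matrix.single k i (1 : ℂ) ∈ S := by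
    intro k i
    by_cases hik : i = k
    · subst hik
      exact hdiag i
    · have : Matrix.single k i (1 : ℂ) =
          (B 1 k i)⁻¹ • (Matrix.single k k 1 * B 1 * Matrix.single i i 1) := by
        have hne := hoff i k hik
        ext l m
        simp [Matrix.single_apply, ite_and]
        by_cases hl : k = l <;> by_cases hm : i = m <;> simp [hl, hm]
        subst hl hm
        simp [hne]
      rw [this]
      exact S.smul_mem (S.mul_mem (S.mul_mem (hdiag k) (hBS 1)) (hdiag i)) _
  intro X
  have hX : ((U⁻¹ : Mat2ˣ) : Mat2) * X * U ∈ S := by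
    rw [Matrix.matrix_eq_sum_single (((U⁻¹ : Mat2ˣ) : Mat2) * X * (U : Mat2))]
    refine S.sum_mem fun i _ => S.sum_mem fun j _ => ?_
    rw [← mul_one ((((U⁻¹ : Mat2ˣ) : Mat2) * X * (U : Mat2)) i j), ← smul_eq_mul, ← Matrix.smul_single]
    exact S.smul_mem (hsingle i j) _
  obtain ⟨p, hp⟩ := hX
  refine ⟨p, ?_⟩
  have := lift_units_conj U B p
  rw [← funext hNB] at this
  rw [this, show FreeAlgebra.lift ℂ B p = _ from hp]
  simp [mul_assoc]

theorem eq_of_prod_eq_one {n R : Type*} [Fintype n] [DecidableEq n] [CommRing R]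
    {a b d x y : Matrix n n R} (hx : a * b * x * d = 1) (hy : a * b * y * d = 1) : x = y := by
  have hx' : x * (d * (a * b)) = 1 := by
    rw [mul_eq_one_comm, mul_assoc, mul_eq_one_comm]
    exact hx
  have hy' : d * (a * b) * y = 1 := by
    rw [mul_assoc, mul_eq_one_comm]
    exact hy
  calc x = x * (d * (a * b) * y) := by rw [hy', mul_one]
    _ = y := by rw [← mul_assoc, hx', one_mul]

/-! ### Constant changes of basis and rescaling of ε -/

/-- A constant invertible matrix over the dual numbers. -/
noncomputable def constUnit (g : Mat2ˣ) : DMat2ˣ :=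
  ⟨dual g 0, dual ((g⁻¹ : Mat2ˣ) : Mat2) 0, by
    rw [← dual_red_infPart (_ * _), map_mul, infPart_mul]
    ext i j <;> by_cases hij : i = j <;> simp [dual, hij, Matrix.one_apply], by
    rw [← dual_red_infPart (_ * _), map_mul, infPart_mul]
    ext i j <;> by_cases hij : i = j <;> simp [dual, hij, Matrix.one_apply]⟩

theorem red_constUnit (g : Mat2ˣ) : red (constUnit g : DMat2) = g := red_dual _ _

theorem red_constUnit_inv (g : Mat2ˣ) :
    red ((constUnit g)⁻¹ : DMat2ˣ) = ((g⁻¹ : Mat2ˣ) : Mat2) := red_dual _ _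

/-- The normal form in another constant basis, in which the last matrix is `c + ε n`. -/
noncomputable def basedFamily (lam : Fin 3 → Fin 2 → ℂ) (c : ℂ) (g : Mat2ˣ) (n : Mat2) :
    Fin 4 → DMat2 :=
  fun j => ((constUnit g)⁻¹ : DMat2ˣ) *
    normalFamily lam c ((g : Mat2) * n * ((g⁻¹ : Mat2ˣ) : Mat2)) j * (constUnit g : DMat2)

theorem nilpotent_conj {n : Mat2} (ht : n.trace = 0) (hd : n.det = 0) (hn : n ≠ 0) (g : Mat2ˣ) :
    ((g : Mat2) * n * ((g⁻¹ : Mat2ˣ) : Mat2)).trace = 0 ∧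
      ((g : Mat2) * n * ((g⁻¹ : Mat2ˣ) : Mat2)).det = 0 ∧
      (g : Mat2) * n * ((g⁻¹ : Mat2ˣ) : Mat2) ≠ 0 := by
  refine ⟨?_, ?_, fun h0 => hn ?_⟩
  · simpa using (trace_units_conj g⁻¹ n).trans ht
  · simpa using (det_units_conj g⁻¹ n).trans hd
  · have := congrArg (fun B : Mat2 => ((g⁻¹ : Mat2ˣ) : Mat2) * B * (g : Mat2)) h0
    simpa [mul_assoc] using this

theorem isDualQuadruple_basedFamily (h : IsRelativelyGenericNotGeneric lam c) (g : Mat2ˣ)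
    {n : Mat2} (ht : n.trace = 0) (hd : n.det = 0) (hn : n ≠ 0) :
    IsDualQuadruple lam c (basedFamily lam c g n) := by
  obtain ⟨ht', hd', hn'⟩ := nilpotent_conj ht hd hn g
  exact (isDualQuadruple_normalFamily h ht' hd' hn').conj (constUnit g)

theorem infPart_basedFamily (g : Mat2ˣ) (n : Mat2) : infPart (basedFamily lam c g n 3) = n := by
  rw [basedFamily, infPart_conj_of_red_eq_smul (c := c) (by rw [normalFamily_three, red_dual]),
    red_constUnit, red_constUnit_inv, normalFamily_three, infPart_dual]
  simp [mul_assoc]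

/-- The parameter n enters only the ε-parts. This is what lets one set of noncommutative polynomials
produce matrix units for all n at once. -/
theorem red_normalFamily_eq (h : IsRelativelyGenericNotGeneric lam c) {n n' : Mat2}
    (ht : n.trace = 0) (hd : n.det = 0) (hn : n ≠ 0)
    (ht' : n'.trace = 0) (hd' : n'.det = 0) (hn' : n' ≠ 0) (j : Fin 4) :
    red (normalFamily lam c n j) = red (normalFamily lam c n' j) := by
  have h1 := (isDualQuadruple_normalFamily h ht hd hn).hasData_red.prod_eq
  have h2 := (isDualQuadruple_normalFamily h ht' hd' hn').hasData_red.prod_eq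
  have e0 : red (normalFamily lam c n 0) = red (normalFamily lam c n' 0) := by
    simp [normalFamily]
  have e1 : red (normalFamily lam c n 1) = red (normalFamily lam c n' 1) := by
    simp [normalFamily]
  have e3 : red (normalFamily lam c n 3) = red (normalFamily lam c n' 3) := by
    simp [normalFamily]
  simp only [e0, e1, e3] at h1
  fin_cases j
  exacts [e0, e1, eq_of_prod_eq_one h1 h2, e3]

theorem red_basedFamily_eq (h : IsRelativelyGenericNotGeneric lam c) (g : Mat2ˣ) {n n' : Mat2}
    (ht : n.trace = 0) (hd : n.det = 0) (hn : n ≠ 0)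
    (ht' : n'.trace = 0) (hd' : n'.det = 0) (hn' : n' ≠ 0) (j : Fin 4) :
    red (basedFamily lam c g n j) = red (basedFamily lam c g n' j) := by
  obtain ⟨k1, k2, k3⟩ := nilpotent_conj ht hd hn g
  obtain ⟨l1, l2, l3⟩ := nilpotent_conj ht' hd' hn' g
  simp only [basedFamily, map_mul]
  rw [red_normalFamily_eq h k1 k2 k3 l1 l2 l3]

/-- The block diagonal matrix `diag (s, 1)`. -/
noncomputable def scaleUnit (s : ℂˣ) : Mat4ˣ :=
  ⟨Matrix.fromBlocks ((s : ℂ) • 1) 0 0 1, Matrix.fromBlocks (((s⁻¹ : ℂˣ) : ℂ) • 1) 0 0 1, by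
    simp [Matrix.fromBlocks_multiply, smul_smul], by
    simp [Matrix.fromBlocks_multiply, smul_smul]⟩

theorem scaleUnit_mul_blockHom (s : ℂˣ) (A : DMat2) :
    (scaleUnit s : Mat4) * blockHom A =
      blockHom (dual (red A) ((s : ℂ) • infPart A)) * (scaleUnit s : Mat4) := by
  rw [blockHom_dual, blockHom_apply]
  simp [scaleUnit, Matrix.fromBlocks_multiply]

/-- Conjugation by diag(s, 1) is the substitution ε ↦ sε, and the ε-parts of the members 0, 1, 3 are
linear in n. The remaining member is determined by the product relation. -/
theorem blockHom_normalFamily_smul (h : IsRelativelyGenericNotGeneric lam c) {n : Mat2}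
    (ht : n.trace = 0) (hd : n.det = 0) (hn : n ≠ 0) (s : ℂˣ) (j : Fin 4) :
    blockHom (normalFamily lam c ((s : ℂ) • n) j) = (scaleUnit s : Mat4) *
      blockHom (normalFamily lam c n j) * ((scaleUnit s)⁻¹ : Mat4ˣ) := by
  have key : ∀ j, j ≠ 2 → dual (red (normalFamily lam c n j))
      ((s : ℂ) • infPart (normalFamily lam c n j)) = normalFamily lam c ((s : ℂ) • n) j := by
    intro j hj
    fin_cases j
    · change dual (red (dual _ _)) (_ • infPart (dual _ _)) = dual _ _
      rw [red_dual, infPart_dual]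
      congr 1
      rw [Matrix.smul_single, Matrix.smul_mul, Matrix.trace_smul, smul_eq_mul, smul_eq_mul]
      congr 1
      ring
    · change dual (red (dual _ _)) (_ • infPart (dual _ _)) = dual _ _
      rw [red_dual, infPart_dual, smul_zero]
    · exact absurd rfl hj
    · change dual (red (dual _ _)) (_ • infPart (dual _ _)) = dual _ _
      rw [red_dual, infPart_dual]
  have key' : ∀ j, j ≠ 2 → blockHom (normalFamily lam c ((s : ℂ) • n) j) = (scaleUnit s : Mat4) *
      blockHom (normalFamily lam c n j) * ((scaleUnit s)⁻¹ : Mat4ˣ) := by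
    intro j hj
    rw [Units.eq_mul_inv_iff_mul_eq, scaleUnit_mul_blockHom, key j hj]
  by_cases hj : j = 2
  · subst hj
    have h1 := congrArg blockHom (isDualQuadruple_normalFamily h ht hd hn).prod_eq
    have h2 := congrArg blockHom (isDualQuadruple_normalFamily h (n := (s : ℂ) • n)
      (by simp [ht]) (by simp [hd]) (by simpa using hn)).prod_eq
    simp only [map_mul, map_one] at h1 h2
    refine eq_of_prod_eq_one h2 ?_
    rw [key' 0 (by decide), key' 1 (by decide), key' 3 (by decide)]
    calc _ = (scaleUnit s : Mat4) * (blockHom (normalFamily lam c n 0) *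
          blockHom (normalFamily lam c n 1) * blockHom (normalFamily lam c n 2) *
          blockHom (normalFamily lam c n 3)) * ((scaleUnit s)⁻¹ : Mat4ˣ) := by
          simp only [mul_assoc, Units.inv_mul_cancel_left]
      _ = 1 := by rw [h1, mul_one, Units.mul_inv]
  · exact key' j hj

theorem blockHom_basedFamily_smul (h : IsRelativelyGenericNotGeneric lam c) (g : Mat2ˣ) {n : Mat2}
    (ht : n.trace = 0) (hd : n.det = 0) (hn : n ≠ 0) (s : ℂˣ) (j : Fin 4) :
    blockHom (basedFamily lam c g ((s : ℂ) • n) j) = (scaleUnit s : Mat4) *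
      blockHom (basedFamily lam c g n j) * ((scaleUnit s)⁻¹ : Mat4ˣ) := by
  obtain ⟨k1, k2, k3⟩ := nilpotent_conj ht hd hn g
  have hconst : ∀ x : Mat2, (scaleUnit s : Mat4) * blockHom (dual x 0) =
      blockHom (dual x 0) * (scaleUnit s : Mat4) := by
    intro x
    rw [scaleUnit_mul_blockHom, red_dual, infPart_dual, smul_zero]
  have e1 : (scaleUnit s : Mat4) * blockHom (constUnit g : DMat2) =
      blockHom (constUnit g : DMat2) * (scaleUnit s : Mat4) := hconst _
  have e2 : (scaleUnit s : Mat4) * blockHom ((constUnit g)⁻¹ : DMat2ˣ) =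
      blockHom ((constUnit g)⁻¹ : DMat2ˣ) * (scaleUnit s : Mat4) := hconst _
  rw [Units.eq_mul_inv_iff_mul_eq]
  simp only [basedFamily, map_mul, Matrix.mul_smul, Matrix.smul_mul]
  rw [blockHom_normalFamily_smul h k1 k2 k3 s j, mul_assoc _ _ (scaleUnit s : Mat4), ← e1]
  simp only [← mul_assoc]
  rw [e2]
  simp only [mul_assoc, Units.inv_mul_cancel_left]

theorem exists_eq_blockHom_normalFamily (hdistinct : ∀ j, lam j 0 ≠ lam j 1)
    (h : IsRelativelyGenericNotGeneric lam c) {M : Fin 4 → Mat4} (hM : M ∈ stratumW lam c) :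
    ∃ (G : Mat4ˣ) (n : Mat2), n.trace = 0 ∧ n.det = 0 ∧ n ≠ 0 ∧
      ∀ j, M j = (G : Mat4) * blockHom (normalFamily lam c n j) * ((G⁻¹ : Mat4ˣ) : Mat4) := by
  obtain ⟨A, hA, G, hG⟩ := (mem_stratumW_iff hdistinct h).1 hM
  obtain ⟨P, n, ht, hd, hn, hP⟩ := hA.exists_conj_eq_normalFamily (hdistinct 0) h
  let Q : Mat4ˣ := Units.map (blockHom : DMat2 →* Mat4) P
  have hQ : (Q : Mat4) = blockHom P := rfl
  have hQ' : ((Q⁻¹ : Mat4ˣ) : Mat4) = blockHom (P⁻¹ : DMat2ˣ) := rfl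
  refine ⟨G * Q, n, ht, hd, hn, fun j => ?_⟩
  rw [hG j, hP j, Units.val_mul, mul_inv_rev, Units.val_mul, hQ, hQ']
  simp only [map_mul, mul_assoc]

theorem exists_conj_basedFamily (lam : Fin 3 → Fin 2 → ℂ) (c : ℂ) (G : Mat4ˣ) (g : Mat2ˣ) :
    ∃ G' : Mat4ˣ, ∀ (n : Mat2) j, (G : Mat4) *
        blockHom (normalFamily lam c ((g : Mat2) * n * ((g⁻¹ : Mat2ˣ) : Mat2)) j) *
        ((G⁻¹ : Mat4ˣ) : Mat4) =
      (G' : Mat4) * blockHom (basedFamily lam c g n j) * ((G'⁻¹ : Mat4ˣ) : Mat4) := by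
  let Q : Mat4ˣ := Units.map (blockHom : DMat2 →* Mat4) (constUnit g)
  have hQ : blockHom (constUnit g : DMat2) = (Q : Mat4) := rfl
  have hQ' : blockHom ((constUnit g)⁻¹ : DMat2ˣ) = ((Q⁻¹ : Mat4ˣ) : Mat4) := rfl
  refine ⟨G * Q, fun n j => ?_⟩
  rw [Units.val_mul, mul_inv_rev, Units.val_mul, basedFamily, map_mul, map_mul, hQ, hQ']
  simp only [mul_assoc, Units.mul_inv_cancel_left]

theorem exists_eq_basedFamily (hdistinct : ∀ j, lam j 0 ≠ lam j 1)
    (h : IsRelativelyGenericNotGeneric lam c) {M : Fin 4 → Mat4} (hM : M ∈ stratumW lam c)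
    (g : Mat2ˣ) : ∃ (G : Mat4ˣ) (n : Mat2), n.trace = 0 ∧ n.det = 0 ∧ n ≠ 0 ∧
      ∀ j, M j = (G : Mat4) * blockHom (basedFamily lam c g n j) * ((G⁻¹ : Mat4ˣ) : Mat4) := by
  obtain ⟨G, n, ht, hd, hn, hG⟩ := exists_eq_blockHom_normalFamily hdistinct h hM
  obtain ⟨k1, k2, k3⟩ := nilpotent_conj ht hd hn g⁻¹
  obtain ⟨G', hG'⟩ := exists_conj_basedFamily lam c G g
  refine ⟨G', _, k1, k2, k3, fun j => ?_⟩
  rw [hG j, ← hG']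
  simp [mul_assoc]

/-! ### Affine coordinate on the lines of nilpotent matrices -/

/-- The non-zero nilpotent matrices with upper right entry one. -/
noncomputable def nilp (t : ℂ) : Mat2 := !![-t, 1; -t ^ 2, t]

theorem trace_nilp (t : ℂ) : (nilp t).trace = 0 := by
  simp [nilp, Matrix.trace_fin_two]

theorem det_nilp (t : ℂ) : (nilp t).det = 0 := by
  simp [nilp, Matrix.det_fin_two]
  ring

theorem nilp_ne_zero (t : ℂ) : nilp t ≠ 0 := by
  intro h
  have := congrFun (congrFun h 0) 1
  simp [nilp] at this

theorem eq_smul_nilp {n : Mat2} (ht : n.trace = 0) (hd : n.det = 0) (h01 : n 0 1 ≠ 0) :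
    n = n 0 1 • nilp (n 1 1 / n 0 1) := by
  rw [Matrix.trace_fin_two] at ht
  rw [Matrix.det_fin_two] at hd
  have h00 : n 0 0 = -n 1 1 := by linear_combination ht
  rw [h00] at hd
  ext i j
  fin_cases i <;> fin_cases j <;> simp [nilp, h00] <;> field_simp
  linear_combination -hd

theorem exists_eq_basedFamily_nilp (hdistinct : ∀ j, lam j 0 ≠ lam j 1)
    (h : IsRelativelyGenericNotGeneric lam c) {M : Fin 4 → Mat4} (hM : M ∈ stratumW lam c)
    (g : Mat2ˣ) :
    (∃ (G : Mat4ˣ) (n : Mat2), n.trace = 0 ∧ n.det = 0 ∧ n ≠ 0 ∧ n 0 1 = 0 ∧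
      ∀ j, M j = (G : Mat4) * blockHom (basedFamily lam c g n j) * ((G⁻¹ : Mat4ˣ) : Mat4)) ∨
    ∃ (G : Mat4ˣ) (t : ℂ),
      ∀ j, M j = (G : Mat4) * blockHom (basedFamily lam c g (nilp t) j) *
        ((G⁻¹ : Mat4ˣ) : Mat4) := by
  obtain ⟨G, n, ht, hd, hn, hG⟩ := exists_eq_basedFamily hdistinct h hM g
  by_cases h01 : n 0 1 = 0
  · exact Or.inl ⟨G, n, ht, hd, hn, h01, hG⟩
  · refine Or.inr ⟨G * scaleUnit (Units.mk0 _ h01), n 1 1 / n 0 1, fun j => ?_⟩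
    rw [hG j]
    conv_lhs => rw [eq_smul_nilp ht hd h01]
    have := blockHom_basedFamily_smul h g (trace_nilp (n 1 1 / n 0 1)) (det_nilp _)
      (nilp_ne_zero _) (Units.mk0 _ h01) j
    rw [Units.val_mk0] at this
    rw [this]
    simp only [Units.val_mul, mul_inv_rev, mul_assoc]

theorem conj_basedFamily_mem_stratumW (hdistinct : ∀ j, lam j 0 ≠ lam j 1)
    (h : IsRelativelyGenericNotGeneric lam c) (G : Mat4ˣ) (g : Mat2ˣ) {n : Mat2}
    (ht : n.trace = 0) (hd : n.det = 0) (hn : n ≠ 0) :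
    (fun j => (G : Mat4) * blockHom (basedFamily lam c g n j) * ((G⁻¹ : Mat4ˣ) : Mat4)) ∈
      stratumW lam c :=
  (mem_stratumW_iff hdistinct h).2
    ⟨_, isDualQuadruple_basedFamily h g ht hd hn, G, fun _ => rfl⟩

/-- The freedom in g places any given point at slope 0, so charts of a single shape suffice. -/
theorem exists_eq_basedFamily_nilp_zero (hdistinct : ∀ j, lam j 0 ≠ lam j 1)
    (h : IsRelativelyGenericNotGeneric lam c) {M : Fin 4 → Mat4} (hM : M ∈ stratumW lam c) :
    ∃ (G : Mat4ˣ) (g : Mat2ˣ),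
      ∀ j, M j = (G : Mat4) * blockHom (basedFamily lam c g (nilp 0) j) *
        ((G⁻¹ : Mat4ˣ) : Mat4) := by
  obtain ⟨G, n, ht, hd, hn, hG⟩ := exists_eq_blockHom_normalFamily hdistinct h hM
  obtain ⟨g, rfl⟩ := exists_eq_conj_single ht hd hn
  have hn0 : Matrix.single 0 1 1 = nilp 0 := by
    ext i j
    fin_cases i <;> fin_cases j <;> simp [nilp]
  obtain ⟨G', hG'⟩ := exists_conj_basedFamily lam c G g
  exact ⟨G', g, fun j => by rw [hG j, hn0, hG']⟩

end Families

end DeligneSimpson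

namespace DeligneSimpson

open TrivSqZeroExt

/-! ### Reconstruction of the parameters of a quadruple -/

section Reconstruction

variable {lam : Fin 3 → Fin 2 → ℂ} {c : ℂ} {p : Fin 2 → Fin 2 → FreeAlgebra ℂ (Fin 4)}

theorem mul_dual_zero (A : DMat2) (R : Mat2) : A * dual 0 R = dual 0 (red A * R) := by
  rw [← dual_red_infPart (A * dual 0 R), map_mul, infPart_mul]
  simp

theorem dual_zero_mul (A : DMat2) (R : Mat2) : dual 0 R * A = dual 0 (R * red A) := by
  rw [← dual_red_infPart (dual 0 R * A), map_mul, infPart_mul]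
  simp

theorem dual_zero_smul (s : ℂ) (R : Mat2) : dual 0 (s • R) = s • dual 0 R := by
  ext i j <;> simp [dual]

theorem dual_zero_add (R R' : Mat2) : dual 0 (R + R') = dual 0 R + dual 0 R' := by
  ext i j <;> simp [dual]

/-- The simultaneous conjugate of the block matrices of `B`. -/
noncomputable def blockConj (G : Mat4ˣ) (B : Fin 4 → DMat2) : Fin 4 → Mat4 :=
  fun j => (G : Mat4) * blockHom (B j) * ((G⁻¹ : Mat4ˣ) : Mat4)

theorem lift_blockConj (G : Mat4ˣ) (B : Fin 4 → DMat2) (q : FreeAlgebra ℂ (Fin 4)) :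
    FreeAlgebra.lift ℂ (blockConj G B) q =
      (G : Mat4) * blockHom (FreeAlgebra.lift ℂ B q) * ((G⁻¹ : Mat4ˣ) : Mat4) := by
  unfold blockConj
  rw [lift_units_conj G (fun j => blockHom (B j)), lift_algHom]

/-- The polynomials `p k l` in a quadruple with values the matrix units. -/
def IsMatrixUnits (p : Fin 2 → Fin 2 → FreeAlgebra ℂ (Fin 4)) (N : Fin 4 → Mat2) : Prop :=
  ∀ k l, FreeAlgebra.lift ℂ N (p k l) = Matrix.single k l 1

theorem IsMatrixUnits.red_lift {B : Fin 4 → DMat2} (hp : IsMatrixUnits p fun j => red (B j))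
    (k l : Fin 2) : red (FreeAlgebra.lift ℂ B (p k l)) = Matrix.single k l 1 := by
  rw [← lift_algHom, hp k l]

/-- Multiples of the matrix units times `ε`. -/
noncomputable def epsUnit (p : Fin 2 → Fin 2 → FreeAlgebra ℂ (Fin 4)) (c : ℂ) (a b k l : Fin 2)
    (M : Fin 4 → Mat4) : Mat4 :=
  FreeAlgebra.lift ℂ M (p k a) * (M 3 - c • (1 : Mat4)) * FreeAlgebra.lift ℂ M (p b l)

theorem single_mul_mul_single (n : Mat2) (a b k l : Fin 2) :
    Matrix.single k a 1 * n * Matrix.single b l 1 = n a b • Matrix.single k l 1 := by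
  ext i j
  simp [Matrix.single_apply, ite_and]

/-- M 3 − c is a multiple of ε, so the unknown ε-parts of the polynomials do not matter, and what
remains is e_ka n e_bl = n_ab e_kl. -/
theorem epsUnit_blockConj (G : Mat4ˣ) {B : Fin 4 → DMat2}
    (hp : IsMatrixUnits p fun j => red (B j)) (h3 : red (B 3) = c • (1 : Mat2)) (a b k l : Fin 2) :
    epsUnit p c a b k l (blockConj G B) = infPart (B 3) a b •
      ((G : Mat4) * blockHom (dual 0 (Matrix.single k l 1)) * ((G⁻¹ : Mat4ˣ) : Mat4)) := by
  have e3 : B 3 = c • (1 : DMat2) + dual 0 (infPart (B 3)) := by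
    conv_lhs => rw [← dual_red_infPart (B 3), h3]
    ext i j <;> by_cases hij : i = j <;> simp [dual, hij]
  have h1 : blockConj G B 3 - c • (1 : Mat4) =
      (G : Mat4) * blockHom (dual 0 (infPart (B 3))) * ((G⁻¹ : Mat4ˣ) : Mat4) := by
    unfold blockConj
    conv_lhs => rw [e3]
    rw [map_add, map_smul, map_one, mul_add, add_mul]
    simp
  have h2 : FreeAlgebra.lift ℂ B (p k a) * dual 0 (infPart (B 3)) * FreeAlgebra.lift ℂ B (p b l) =
      infPart (B 3) a b • dual 0 (Matrix.single k l 1) := by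
    rw [mul_dual_zero, dual_zero_mul, hp.red_lift, hp.red_lift, single_mul_mul_single,
      dual_zero_smul]
  rw [epsUnit, h1, lift_blockConj, lift_blockConj]
  calc _ = (G : Mat4) * blockHom (FreeAlgebra.lift ℂ B (p k a) * dual 0 (infPart (B 3)) *
        FreeAlgebra.lift ℂ B (p b l)) * ((G⁻¹ : Mat4ˣ) : Mat4) := by
        simp only [map_mul, mul_assoc, Units.inv_mul_cancel_left]
    _ = _ := by
        rw [h2, map_smul, mul_smul_comm, smul_mul_assoc]

/-- An entry of `ε` times a matrix unit. -/
noncomputable def epsEntry (p : Fin 2 → Fin 2 → FreeAlgebra ℂ (Fin 4)) (c : ℂ)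
    (M : Fin 4 → Mat4) : ℂ :=
  epsUnit p c 0 1 0 0 M (Sum.inl 0) (Sum.inr 0)

/-- The slope of the nilpotent matrix of a quadruple. -/
noncomputable def slope (p : Fin 2 → Fin 2 → FreeAlgebra ℂ (Fin 4)) (c : ℂ)
    (M : Fin 4 → Mat4) : ℂ :=
  epsUnit p c 1 1 0 0 M (Sum.inl 0) (Sum.inr 0) / epsEntry p c M

/-- Requiring `epsEntry` to be non-zero keeps out of the chart the quadruples whose n is not a
multiple of any `nilp t`. -/
theorem epsEntry_blockConj_eq_zero (G : Mat4ˣ) {B : Fin 4 → DMat2}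
    (hp : IsMatrixUnits p fun j => red (B j)) (h3 : red (B 3) = c • (1 : Mat2))
    (h01 : infPart (B 3) 0 1 = 0) : epsEntry p c (blockConj G B) = 0 := by
  rw [epsEntry, epsUnit_blockConj G hp h3, h01, zero_smul, Matrix.zero_apply]

/-- Numerator and denominator are n₁₁ and n₀₁ times the same entry depending on G, which cancels. -/
theorem slope_blockConj (G : Mat4ˣ) {B : Fin 4 → DMat2}
    (hp : IsMatrixUnits p fun j => red (B j)) (h3 : red (B 3) = c • (1 : Mat2)) {t : ℂ}
    (hn : infPart (B 3) = nilp t) (h0 : epsEntry p c (blockConj G B) ≠ 0) :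
    slope p c (blockConj G B) = t := by
  rw [slope, div_eq_iff h0, epsEntry, epsUnit_blockConj G hp h3, epsUnit_blockConj G hp h3, hn]
  simp [nilp]

/-- The matrix units of a quadruple that is conjugate to a member of the family `S`. -/
noncomputable def matrixUnit (S : ℂ → Fin 4 → Mat4) (p : Fin 2 → Fin 2 → FreeAlgebra ℂ (Fin 4))
    (c : ℂ) (k l : Fin 2) (M : Fin 4 → Mat4) : Mat4 :=
  FreeAlgebra.lift ℂ M (p k l) - ∑ a, ∑ b,
    FreeAlgebra.lift ℂ (S (slope p c M)) (p k l) (Sum.inl a) (Sum.inr b) • epsUnit p c 0 1 a b M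

/-- The basis in which a quadruple is a member of the family `S`. -/
noncomputable def frame (S : ℂ → Fin 4 → Mat4) (p : Fin 2 → Fin 2 → FreeAlgebra ℂ (Fin 4))
    (c : ℂ) (M : Fin 4 → Mat4) : Mat4 :=
  Matrix.of fun i => Sum.elim
    (fun k => (matrixUnit S p c k 0 M * ∑ a, epsUnit p c 0 1 a a M) i (Sum.inr 0))
    (fun k => matrixUnit S p c k 0 M i (Sum.inr 0))

/-- The polynomial p k l gives the matrix unit up to an ε-part that is the same as in the model with
slope t. It can be read off there and subtracted by means of the already available ε e_ab. -/
theorem matrixUnit_blockConj (G : Mat4ˣ) {B : ℂ → Fin 4 → DMat2} {t : ℂ}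
    (hp : IsMatrixUnits p fun j => red (B t j)) (h3 : red (B t 3) = c • (1 : Mat2))
    (hn : infPart (B t 3) = nilp t) (h0 : epsEntry p c (blockConj G (B t)) ≠ 0) (k l : Fin 2) :
    matrixUnit (fun t j => blockHom (B t j)) p c k l (blockConj G (B t)) =
      (G : Mat4) * blockHom (dual (Matrix.single k l 1) 0) * ((G⁻¹ : Mat4ˣ) : Mat4) := by
  rw [matrixUnit, slope_blockConj G hp h3 hn h0, lift_algHom, lift_blockConj]
  set Y := FreeAlgebra.lift ℂ (B t) (p k l) with hY
  have h1 : ∀ a b, epsUnit p c 0 1 a b (blockConj G (B t)) =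
      (G : Mat4) * blockHom (dual 0 (Matrix.single a b 1)) * ((G⁻¹ : Mat4ˣ) : Mat4) := by
    intro a b
    rw [epsUnit_blockConj G hp h3, hn]
    simp [nilp]
  have h2 : ∑ a, ∑ b, blockHom Y (Sum.inl a) (Sum.inr b) • epsUnit p c 0 1 a b (blockConj G (B t))
      = (G : Mat4) * blockHom (dual 0 (infPart Y)) * ((G⁻¹ : Mat4ˣ) : Mat4) := by
    have : dual 0 (infPart Y) =
        ∑ a, ∑ b, infPart Y a b • dual 0 (Matrix.single a b 1) := by
      conv_lhs => rw [Matrix.matrix_eq_sum_single (infPart Y)]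
      simp only [Fin.sum_univ_two, dual_zero_add, ← dual_zero_smul, Matrix.smul_single,
        smul_eq_mul, mul_one]
    rw [this]
    simp only [h1, map_sum, map_smul, Finset.mul_sum, Finset.sum_mul, mul_smul_comm,
      smul_mul_assoc, blockHom_apply, Matrix.fromBlocks_apply₁₂]
  rw [h2, ← sub_mul, ← mul_sub, ← map_sub]
  congr 3
  rw [← hp.red_lift k l, ← hY]
  ext i j <;> simp [dual, infPart, red_apply]

/-- The columns are ε e_k0 and e_k0, in the basis G, applied to one fixed vector. Hence the frame is
G up to a factor commuting with the whole family, whose scalars x, y are the coordinates of that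
vector. -/
theorem frame_blockConj (G : Mat4ˣ) {B : ℂ → Fin 4 → DMat2} {t : ℂ}
    (hp : IsMatrixUnits p fun j => red (B t j)) (h3 : red (B t 3) = c • (1 : Mat2))
    (hn : infPart (B t 3) = nilp t) (h0 : epsEntry p c (blockConj G (B t)) ≠ 0) :
    frame (fun t j => blockHom (B t j)) p c (blockConj G (B t)) = (G : Mat4) *
      blockHom (dual (((G⁻¹ : Mat4ˣ) : Mat4) (Sum.inr 0) (Sum.inr 0) • 1)
        (((G⁻¹ : Mat4ˣ) : Mat4) (Sum.inl 0) (Sum.inr 0) • 1)) := by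
  have h1 : ∑ a, epsUnit p c 0 1 a a (blockConj G (B t)) =
      (G : Mat4) * blockHom (dual 0 1) * ((G⁻¹ : Mat4ˣ) : Mat4) := by
    have : dual 0 1 = ∑ a, dual 0 (Matrix.single a a 1) := by
      rw [Fin.sum_univ_two, ← dual_zero_add]
      congr 1
      ext i j
      fin_cases i <;> fin_cases j <;> simp
    rw [this]
    simp only [map_sum, Finset.mul_sum, Finset.sum_mul]
    refine Finset.sum_congr rfl fun a _ => ?_
    rw [epsUnit_blockConj G hp h3, hn]
    simp [nilp]
  have h2 : ∀ k, matrixUnit (fun t j => blockHom (B t j)) p c k 0 (blockConj G (B t)) *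
      ∑ a, epsUnit p c 0 1 a a (blockConj G (B t)) =
      (G : Mat4) * blockHom (dual 0 (Matrix.single k 0 1)) * ((G⁻¹ : Mat4ˣ) : Mat4) := by
    intro k
    rw [h1, matrixUnit_blockConj G hp h3 hn h0]
    calc _ = (G : Mat4) * blockHom (dual (Matrix.single k 0 1) 0 * dual 0 1) *
          ((G⁻¹ : Mat4ˣ) : Mat4) := by
          simp only [map_mul, mul_assoc, Units.inv_mul_cancel_left]
      _ = _ := by rw [mul_dual_zero, red_dual, mul_one]
  ext i j
  rcases j with k | k
  · simp only [frame, Matrix.of_apply, Sum.elim_inl]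
    rw [h2, mul_assoc, Matrix.mul_apply, Matrix.mul_apply, Fintype.sum_sum_type,
      Fintype.sum_sum_type]
    fin_cases k <;>
    simp [blockHom_dual, Matrix.mul_apply, Matrix.single_apply]
  · simp only [frame, Matrix.of_apply, Sum.elim_inr]
    rw [matrixUnit_blockConj G hp h3 hn h0, mul_assoc, Matrix.mul_apply, Matrix.mul_apply,
      Fintype.sum_sum_type, Fintype.sum_sum_type]
    fin_cases k <;>
    simp [blockHom_dual, Matrix.mul_apply, Matrix.single_apply]

theorem blockHom_central_comm (x y : ℂ) (A : DMat2) :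
    blockHom (dual (x • 1) (y • 1)) * blockHom A = blockHom A * blockHom (dual (x • 1) (y • 1)) := by
  rw [blockHom_dual, blockHom_apply]
  simp [Matrix.fromBlocks_multiply, add_comm]

/-- A quadruple is the member of the family `S` in the basis given by its frame. -/
theorem eq_frame_conj (G : Mat4ˣ) {B : ℂ → Fin 4 → DMat2} {t : ℂ}
    (hp : IsMatrixUnits p fun j => red (B t j)) (h3 : red (B t 3) = c • (1 : Mat2))
    (hn : infPart (B t 3) = nilp t) (h0 : epsEntry p c (blockConj G (B t)) ≠ 0) {F : Mat4}
    (hF : F = frame (fun t j => blockHom (B t j)) p c (blockConj G (B t))) (hdet : F.det ≠ 0) :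
    (∀ j, blockConj G (B t) j = F * blockHom (B t j) * F⁻¹) ∧
      F⁻¹ (Sum.inl 0) (Sum.inr 0) = 0 ∧ F⁻¹ (Sum.inr 0) (Sum.inr 0) = 1 := by
  rw [frame_blockConj G hp h3 hn h0] at hF
  set x := ((G⁻¹ : Mat4ˣ) : Mat4) (Sum.inr 0) (Sum.inr 0) with hx
  set y := ((G⁻¹ : Mat4ˣ) : Mat4) (Sum.inl 0) (Sum.inr 0) with hy
  set z := blockHom (dual (x • 1) (y • 1)) with hz
  have hFu : IsUnit F.det := isUnit_iff_ne_zero.2 hdet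
  have hzF : z * F⁻¹ = ((G⁻¹ : Mat4ˣ) : Mat4) := by
    have : (G : Mat4) * (z * F⁻¹) = 1 := by
      rw [← mul_assoc, ← hF, Matrix.mul_nonsing_inv _ hFu]
    rw [← mul_one ((G⁻¹ : Mat4ˣ) : Mat4), ← this, Units.inv_mul_cancel_left]
  refine ⟨fun j => ?_, ?_⟩
  · rw [hF, mul_assoc (G : Mat4), hz, blockHom_central_comm, ← hz, ← hF, blockConj, ← hzF]
    simp only [mul_assoc]
  have hx0 : x ≠ 0 := by
    intro hx0
    refine hdet ?_
    rw [hF, Matrix.det_mul, hz, det_blockHom, red_dual, hx0]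
    simp
  -- Column `inr 0` of z F⁻¹ = G⁻¹ reads x F⁻¹(inr 0, inr 0) = x and x F⁻¹(inl 0, inr 0) + y F⁻¹(inr
  -- 0, inr 0) = y, which forces the entries 1 and 0.
  have e1 := congrFun (congrFun hzF (Sum.inr 0)) (Sum.inr 0)
  have e2 := congrFun (congrFun hzF (Sum.inl 0)) (Sum.inr 0)
  rw [← hx, hz, blockHom_dual] at e1
  rw [← hy, hz, blockHom_dual] at e2
  simp only [Matrix.mul_apply, Fintype.sum_sum_type, Fin.sum_univ_two, Matrix.fromBlocks_apply₁₁,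
    Matrix.fromBlocks_apply₁₂, Matrix.fromBlocks_apply₂₁, Matrix.fromBlocks_apply₂₂,
    Matrix.smul_apply, Matrix.one_apply, smul_eq_mul, Matrix.zero_apply] at e1 e2
  simp at e1 e2
  have h11 : F⁻¹ (Sum.inr 0) (Sum.inr 0) = 1 :=
    mul_left_cancel₀ hx0 (e1.trans (mul_one x).symm)
  refine ⟨?_, h11⟩
  rw [h11] at e2
  simpa [hx0] using e2

end Reconstruction

/-! ### Regularity of the constructions -/

section Regularity

variable {σ : Type*} {lam : Fin 3 → Fin 2 → ℂ} {c : ℂ}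
  {p : Fin 2 → Fin 2 → FreeAlgebra ℂ (Fin 4)}

/-- Regularity of maps to matrices over the dual numbers. -/
def RegDMatAt (F : (σ → ℂ) → DMat2) (x : σ → ℂ) : Prop :=
  RegMatAt (fun y => red (F y)) x ∧ RegMatAt (fun y => infPart (F y)) x

theorem RegDMatAt.dual {N R : (σ → ℂ) → Mat2} {x : σ → ℂ} (hN : RegMatAt N x)
    (hR : RegMatAt R x) : RegDMatAt (fun y => dual (N y) (R y)) x := by
  simpa [RegDMatAt] using ⟨hN, hR⟩

theorem RegDMatAt.const (A : DMat2) (x : σ → ℂ) : RegDMatAt (fun _ => A) x :=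
  ⟨RegMatAt.const _ x, RegMatAt.const _ x⟩

theorem RegDMatAt.mul {F F' : (σ → ℂ) → DMat2} {x : σ → ℂ} (hF : RegDMatAt F x)
    (hF' : RegDMatAt F' x) : RegDMatAt (fun y => F y * F' y) x := by
  constructor
  · simpa only [map_mul] using hF.1.mul hF'.1
  · simpa only [infPart_mul] using (hF.1.mul hF'.2).add (hF.2.mul hF'.1)

theorem RegDMatAt.smul_adjugate (d : ℂ) {F : (σ → ℂ) → DMat2} {x : σ → ℂ} (hF : RegDMatAt F x) :
    RegDMatAt (fun y => (inl d : DualNumber ℂ) • (F y).adjugate) x := by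
  have h1 : ∀ i j, RegAt (fun y => (F y i j).fst) x := hF.1
  have h2 : ∀ i j, RegAt (fun y => (F y i j).snd) x := hF.2
  constructor <;> intro i j <;> simp only [Matrix.adjugate_fin_two] <;>
    fin_cases i <;> fin_cases j <;> simp [red_apply, infPart] <;>
    first
    | exact (RegAt.const d x).mul (h1 _ _)
    | exact ((RegAt.const d x).mul (h1 _ _)).neg
    | exact (RegAt.const d x).mul (h2 _ _)
    | exact ((RegAt.const d x).mul (h2 _ _)).neg

theorem RegDMatAt.blockHom {F : (σ → ℂ) → DMat2} {x : σ → ℂ} (hF : RegDMatAt F x) :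
    RegMatAt (fun y => blockHom (F y)) x :=
  RegMatAt.fromBlocks hF.1 hF.2 (RegMatAt.const _ x) hF.1

theorem RegMatAt.normalFamily {n : (σ → ℂ) → Mat2} {x : σ → ℂ} (hn : RegMatAt n x) (j : Fin 4) :
    RegDMatAt (fun y => normalFamily lam c (n y) j) x := by
  have h0 : RegDMatAt (fun y => DeligneSimpson.normalFamily lam c (n y) 0) x := by
    refine RegDMatAt.dual (RegMatAt.const _ x) fun i k => ?_
    have hf : RegAt (fun y => -(c⁻¹ * (n y * (normalFst lam c * normalSnd lam)).trace)) x :=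
      ((RegAt.const _ x).mul (hn.mul (RegMatAt.const _ x)).trace).neg
    by_cases hik : 0 = i ∧ 1 = k
    · obtain ⟨rfl, rfl⟩ := hik
      simpa using hf
    · simpa [Matrix.single_apply, hik] using RegAt.const 0 x
  have h1 : RegDMatAt (fun y => DeligneSimpson.normalFamily lam c (n y) 1) x :=
    RegDMatAt.const _ x
  have h3 : RegDMatAt (fun y => DeligneSimpson.normalFamily lam c (n y) 3) x :=
    RegDMatAt.dual (RegMatAt.const _ x) hn
  fin_cases j
  exacts [h0, h1, (h3.mul (h0.mul h1)).smul_adjugate _, h3]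

theorem RegMatAt.nilp {f : (σ → ℂ) → ℂ} {x : σ → ℂ} (hf : RegAt f x) :
    RegMatAt (fun y => nilp (f y)) x := by
  intro i j
  fin_cases i <;> fin_cases j <;> simp [DeligneSimpson.nilp]
  · exact hf.neg
  · exact RegAt.const 1 x
  · simpa [sq] using (hf.mul hf).neg
  · exact hf

theorem RegMatAt.basedFamily (g : Mat2ˣ) {n : (σ → ℂ) → Mat2} {x : σ → ℂ} (hn : RegMatAt n x)
    (j : Fin 4) : RegDMatAt (fun y => basedFamily lam c g (n y) j) x :=
  ((RegDMatAt.const _ x).mul (RegMatAt.normalFamily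
    (((RegMatAt.const _ x).mul hn).mul (RegMatAt.const _ x)) j)).mul (RegDMatAt.const _ x)

variable {M : (σ → ℂ) → Fin 4 → Mat4} {x : σ → ℂ}

theorem regMatAt_epsUnit (hM : ∀ j, RegMatAt (fun y => M y j) x) (a b k l : Fin 2) :
    RegMatAt (fun y => epsUnit p c a b k l (M y)) x :=
  ((RegMatAt.freeAlgebra_lift hM _).mul ((hM 3).sub (RegMatAt.const _ x))).mul
    (RegMatAt.freeAlgebra_lift hM _)

theorem regAt_epsEntry (hM : ∀ j, RegMatAt (fun y => M y j) x) :
    RegAt (fun y => epsEntry p c (M y)) x :=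
  regMatAt_epsUnit hM _ _ _ _ _ _

theorem regAt_slope (hM : ∀ j, RegMatAt (fun y => M y j) x) (h0 : epsEntry p c (M x) ≠ 0) :
    RegAt (fun y => slope p c (M y)) x :=
  RegAt.div (regMatAt_epsUnit hM _ _ _ _ _ _) (regAt_epsEntry hM) h0

theorem regMatAt_frame (g : Mat2ˣ) (hM : ∀ j, RegMatAt (fun y => M y j) x)
    (h0 : epsEntry p c (M x) ≠ 0) :
    RegMatAt (fun y => frame (fun t j => blockHom (basedFamily lam c g (nilp t) j)) p c (M y)) x := by
  have h1 : ∀ k l, RegMatAt (fun y => matrixUnit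
      (fun t j => blockHom (basedFamily lam c g (nilp t) j)) p c k l (M y)) x := by
    intro k l
    refine (RegMatAt.freeAlgebra_lift hM _).sub (RegMatAt.sum _ fun a _ => RegMatAt.sum _ fun b _ =>
      RegMatAt.smul ?_ (regMatAt_epsUnit hM _ _ _ _))
    exact RegMatAt.freeAlgebra_lift (fun j =>
      (RegMatAt.basedFamily g (RegMatAt.nilp (regAt_slope hM h0)) j).blockHom) _ _ _
  intro i j
  rcases j with k | k
  · exact (h1 k 0).mul (RegMatAt.sum _ fun a _ => regMatAt_epsUnit hM _ _ _ _) _ _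
  · exact h1 k 0 _ _

end Regularity

end DeligneSimpson

namespace DeligneSimpson

open TrivSqZeroExt

/-! ### Charts of the stratum -/

section Charts

variable {lam : Fin 3 → Fin 2 → ℂ} {c : ℂ}

/-- The coordinates of a chart: the free entries of a matrix of size four with two prescribed
entries, and a slope. -/
abbrev ChartIndex : Type :=
  Option {q : (Fin 2 ⊕ Fin 2) × (Fin 2 ⊕ Fin 2) //
    q ≠ (Sum.inl 0, Sum.inr 0) ∧ q ≠ (Sum.inr 0, Sum.inr 0)}

/-- Sixteen entries, less the two normalised ones, plus the slope. -/
theorem card_chartIndex : Fintype.card ChartIndex = 15 := by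
  decide

/-- The matrix with the given free entries. -/
noncomputable def chartMatrix (u : ChartIndex → ℂ) : Mat4 :=
  Matrix.of fun i j =>
    if h : (i, j) ≠ (Sum.inl 0, Sum.inr 0) ∧ (i, j) ≠ (Sum.inr 0, Sum.inr 0) then
      u (some ⟨(i, j), h⟩)
    else if i = Sum.inr 0 then 1 else 0

/-- The free entries of a matrix, and a slope. -/
def chartCoords (H : Mat4) (t : ℂ) : ChartIndex → ℂ
  | none => t
  | some q => H q.1.1 q.1.2

theorem chartMatrix_chartCoords {H : Mat4} (h0 : H (Sum.inl 0) (Sum.inr 0) = 0)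
    (h1 : H (Sum.inr 0) (Sum.inr 0) = 1) (t : ℂ) : chartMatrix (chartCoords H t) = H := by
  ext i j
  by_cases hij : (i, j) ≠ (Sum.inl 0, Sum.inr 0) ∧ (i, j) ≠ (Sum.inr 0, Sum.inr 0)
  · rw [chartMatrix, Matrix.of_apply, dif_pos hij]
    rfl
  · rw [chartMatrix, Matrix.of_apply, dif_neg hij]
    rw [not_and_or, not_not, not_not] at hij
    rcases hij with hij | hij <;> obtain ⟨rfl, rfl⟩ := Prod.mk.inj hij
    · simp [h0]
    · simp [h1]

theorem chartCoords_chartMatrix (u : ChartIndex → ℂ) :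
    chartCoords (chartMatrix u) (u none) = u := by
  funext q
  rcases q with _ | ⟨q, hq⟩
  · rfl
  · rw [chartCoords, chartMatrix, Matrix.of_apply, dif_pos hq]

theorem chartMatrix_inl (u : ChartIndex → ℂ) :
    chartMatrix u (Sum.inl 0) (Sum.inr 0) = 0 := by
  simp [chartMatrix]

theorem chartMatrix_inr (u : ChartIndex → ℂ) :
    chartMatrix u (Sum.inr 0) (Sum.inr 0) = 1 := by
  simp [chartMatrix]

theorem regMatAt_chartMatrix (u : ChartIndex → ℂ) : RegMatAt chartMatrix u := by
  intro i j
  by_cases hij : (i, j) ≠ (Sum.inl 0, Sum.inr 0) ∧ (i, j) ≠ (Sum.inr 0, Sum.inr 0)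
  · simpa only [chartMatrix, Matrix.of_apply, dif_pos hij] using RegAt.coord _ u
  · simpa only [chartMatrix, Matrix.of_apply, dif_neg hij] using RegAt.const _ u

/-- Index of the entries of a quadruple. -/
abbrev EntryIndex : Type := Fin 4 × (Fin 2 ⊕ Fin 2) × (Fin 2 ⊕ Fin 2)

/-- The quadruple of matrices with the given entries, conjugated by `G⁻¹`. -/
noncomputable def pullback (G : Mat4ˣ) (y : EntryIndex → ℂ) : Fin 4 → Mat4 :=
  fun j => ((G⁻¹ : Mat4ˣ) : Mat4) * Matrix.of (fun a b => y (j, a, b)) * (G : Mat4)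

theorem regMatAt_pullback (G : Mat4ˣ) (y : EntryIndex → ℂ) (j : Fin 4) :
    RegMatAt (fun y => pullback G y j) y :=
  ((RegMatAt.const _ y).mul fun _ _ => RegAt.coord _ y).mul (RegMatAt.const _ y)

theorem pullback_coords (G : Mat4ˣ) (M : Fin 4 → Mat4) (j : Fin 4) :
    pullback G (coords M) j = ((G⁻¹ : Mat4ˣ) : Mat4) * M j * (G : Mat4) := rfl

theorem pullback_coords_blockConj (G G' : Mat4ˣ) (B : Fin 4 → DMat2) :
    pullback G (coords (blockConj G' B)) = blockConj (G⁻¹ * G') B := by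
  funext j
  rw [pullback_coords, blockConj, blockConj]
  simp [mul_assoc]

/-- The parametrization of a neighbourhood of a point of the stratum. -/
noncomputable def chartMap (lam : Fin 3 → Fin 2 → ℂ) (c : ℂ) (g : Mat2ˣ) (G : Mat4ˣ)
    (u : ChartIndex → ℂ) : EntryIndex → ℂ :=
  coords fun j => (G : Mat4) * ((chartMatrix u)⁻¹ * blockHom (basedFamily lam c g (nilp (u none)) j) *
    chartMatrix u) * ((G⁻¹ : Mat4ˣ) : Mat4)

theorem regAt_chartMap (g : Mat2ˣ) (G : Mat4ˣ) {u : ChartIndex → ℂ}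
    (hu : (chartMatrix u).det ≠ 0) (k : EntryIndex) :
    RegAt (fun u => chartMap lam c g G u k) u := by
  have hS : RegMatAt (fun u : ChartIndex → ℂ =>
      blockHom (basedFamily lam c g (nilp (u none)) k.1)) u :=
    (RegMatAt.basedFamily g (RegMatAt.nilp (RegAt.coord none u)) k.1).blockHom
  exact (((RegMatAt.const _ u).mul ((((regMatAt_chartMatrix u).inv hu).mul hS).mul
    (regMatAt_chartMatrix u))).mul (RegMatAt.const _ u)) k.2.1 k.2.2

theorem chartMap_eq (g : Mat2ˣ) (G : Mat4ˣ) {u : ChartIndex → ℂ} {H : Mat4ˣ}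
    (hH : (H : Mat4) = chartMatrix u) :
    chartMap lam c g G u = coords (blockConj (G * H⁻¹) (basedFamily lam c g (nilp (u none)))) := by
  rw [chartMap, ← hH]
  congr 1
  funext j
  rw [blockConj, ← Matrix.coe_units_inv]
  simp [mul_assoc]

theorem pullback_chartMap (g : Mat2ˣ) (G : Mat4ˣ) {u : ChartIndex → ℂ} {H : Mat4ˣ}
    (hH : (H : Mat4) = chartMatrix u) :
    pullback G (chartMap lam c g G u) =
      blockConj H⁻¹ (basedFamily lam c g (nilp (u none))) := by
  rw [chartMap_eq g G hH, pullback_coords_blockConj, inv_mul_cancel_left]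

theorem exists_units_eq {H : Mat4} (h : H.det ≠ 0) : ∃ U : Mat4ˣ, (U : Mat4) = H :=
  (Matrix.isUnit_iff_isUnit_det H).2 (isUnit_iff_ne_zero.2 h)

theorem exists_isMatrixUnits (hdistinct : ∀ j, lam j 0 ≠ lam j 1)
    (h : IsRelativelyGenericNotGeneric lam c) (g : Mat2ˣ) :
    ∃ p : Fin 2 → Fin 2 → FreeAlgebra ℂ (Fin 4), ∀ n : Mat2, n.trace = 0 → n.det = 0 → n ≠ 0 →
      IsMatrixUnits p fun j => red (basedFamily lam c g n j) := by
  have hsurj := (isDualQuadruple_basedFamily h g (trace_nilp 0) (det_nilp 0)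
    (nilp_ne_zero 0)).lift_red_surjective (hdistinct 0) h
  refine ⟨fun k l => (hsurj (Matrix.single k l 1)).choose, fun n ht hd hn => ?_⟩
  have hN : (fun j => red (basedFamily lam c g n j)) =
      fun j => red (basedFamily lam c g (nilp 0) j) := funext fun j =>
    red_basedFamily_eq h g ht hd hn (trace_nilp 0) (det_nilp 0) (nilp_ne_zero 0) j
  rw [hN]
  exact fun k l => (hsurj (Matrix.single k l 1)).choose_spec

/-- The parametrization sends (H, t) to the model of slope t conjugated by G H⁻¹, and the given
point is H = 1, t = 0. Its inverse pulls back by G and takes the slope and the inverse of the frame.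
-/
theorem exists_chart (hdistinct : ∀ j, lam j 0 ≠ lam j 1)
    (h : IsRelativelyGenericNotGeneric lam c) {x : EntryIndex → ℂ}
    (hx : x ∈ coords '' stratumW lam c) :
    ∃ (φ : (ChartIndex → ℂ) → EntryIndex → ℂ) (ψ : (EntryIndex → ℂ) → ChartIndex → ℂ)
      (V : Set (Aff ChartIndex)) (O : Set (Aff EntryIndex)), IsOpen V ∧ IsOpen O ∧ x ∈ O ∧
        (∀ u ∈ V, ∀ k, RegAt (fun u => φ u k) u) ∧ (∀ y ∈ O, ∀ i, RegAt (fun y => ψ y i) y) ∧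
        (∀ u ∈ V, φ u ∈ coords '' stratumW lam c ∧ φ u ∈ O ∧ ψ (φ u) = u) ∧
        ∀ y ∈ coords '' stratumW lam c, y ∈ O → ψ y ∈ V ∧ φ (ψ y) = y := by
  obtain ⟨M, hM, rfl⟩ := hx
  obtain ⟨G, g, hG⟩ := exists_eq_basedFamily_nilp_zero hdistinct h hM
  replace hG : M = blockConj G (basedFamily lam c g (nilp 0)) := funext hG
  obtain ⟨p, hp⟩ := exists_isMatrixUnits hdistinct h g
  let B : ℂ → Fin 4 → DMat2 := fun t => basedFamily lam c g (nilp t)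
  have hB : ∀ t, IsDualQuadruple lam c (B t) := fun t =>
    isDualQuadruple_basedFamily h g (trace_nilp t) (det_nilp t) (nilp_ne_zero t)
  have hpB : ∀ t, IsMatrixUnits p fun j => red (B t j) := fun t =>
    hp _ (trace_nilp t) (det_nilp t) (nilp_ne_zero t)
  have hnB : ∀ t, infPart (B t 3) = nilp t := fun t => infPart_basedFamily g _
  let S : ℂ → Fin 4 → Mat4 := fun t j => blockHom (B t j)
  let e : (EntryIndex → ℂ) → ℂ := fun y => epsEntry p c (pullback G y)
  let F : (EntryIndex → ℂ) → Mat4 := fun y => frame S p c (pullback G y)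
  have he : ∀ y, RegAt e y := fun y => regAt_epsEntry (regMatAt_pullback G y)
  have hF : ∀ y, e y ≠ 0 → RegMatAt F y := fun y hy =>
    regMatAt_frame g (regMatAt_pullback G y) hy
  let φ := chartMap lam c g G
  let ψ : (EntryIndex → ℂ) → ChartIndex → ℂ :=
    fun y => chartCoords (F y)⁻¹ (slope p c (pullback G y))
  let O₁ : Set (Aff EntryIndex) := {y | y ∈ (Set.univ : Set (Aff EntryIndex)) ∧ e y ≠ 0}
  let O : Set (Aff EntryIndex) := {y | y ∈ O₁ ∧ (F y).det ≠ 0}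
  let V₁ : Set (Aff ChartIndex) :=
    {u | u ∈ (Set.univ : Set (Aff ChartIndex)) ∧ (chartMatrix u).det ≠ 0}
  let V : Set (Aff ChartIndex) := {u | u ∈ V₁ ∧ e (φ u) ≠ 0}
  have hO₁ : IsOpen O₁ := isOpen_setOf_ne_zero isOpen_univ fun y _ => he y
  have hO : IsOpen O := isOpen_setOf_ne_zero hO₁ fun y hy => (hF y hy.2).det
  have hV₁ : IsOpen V₁ := isOpen_setOf_ne_zero isOpen_univ fun u _ => (regMatAt_chartMatrix u).det
  have hφ : ∀ u ∈ V₁, ∀ k, RegAt (fun u => φ u k) u := fun u hu k => regAt_chartMap g G hu.2 k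
  have hV : IsOpen V := isOpen_setOf_ne_zero hV₁ fun u hu => (he _).comp (hφ u hu)
  refine ⟨φ, ψ, V, O, hV, hO, ?_, fun u hu => hφ u hu.1, ?_, ?_, ?_⟩
  · have hpull : pullback G (coords M) = blockConj 1 (B 0) := by
      rw [hG, pullback_coords_blockConj, inv_mul_cancel]
    have he0 : epsEntry p c (blockConj 1 (B 0)) ≠ 0 := by
      rw [epsEntry, epsUnit_blockConj 1 (hpB 0) (hB 0).red_last, hnB]
      simp [nilp, blockHom_dual]
    have hF0 : frame S p c (blockConj 1 (B 0)) = 1 := by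
      rw [frame_blockConj 1 (hpB 0) (hB 0).red_last (hnB 0) he0]
      simp [blockHom_dual]
    refine ⟨⟨trivial, ?_⟩, ?_⟩
    · change epsEntry p c (pullback G (coords M)) ≠ 0
      rwa [hpull]
    · change (frame S p c (pullback G (coords M))).det ≠ 0
      rw [hpull, hF0, Matrix.det_one]
      exact one_ne_zero
  · rintro y ⟨⟨-, hy⟩, hdet⟩ (_ | q)
    · exact regAt_slope (regMatAt_pullback G y) hy
    · exact (hF y hy).inv hdet _ _
  · intro (u : ChartIndex → ℂ) ⟨⟨_, hu⟩, heu⟩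
    obtain ⟨H, hH⟩ := exists_units_eq hu
    have hpull : pullback G (φ u) = blockConj H⁻¹ (B (u none)) := pullback_chartMap g G hH
    have he0 : epsEntry p c (blockConj H⁻¹ (B (u none))) ≠ 0 := by
      rw [← hpull]
      exact heu
    -- The two prescribed entries of H are the scalars x = 1, y = 0 of the commuting factor, which
    -- is thus the identity.
    have hFu : F (φ u) = ((H⁻¹ : Mat4ˣ) : Mat4) := by
      change frame S p c (pullback G (φ u)) = _
      rw [hpull, frame_blockConj H⁻¹ (hpB _) (hB _).red_last (hnB _) he0, inv_inv, hH,
        chartMatrix_inl, chartMatrix_inr]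
      simp [blockHom_dual]
    refine ⟨?_, ⟨⟨trivial, heu⟩, ?_⟩, ?_⟩
    · refine ⟨_, conj_basedFamily_mem_stratumW hdistinct h (G * H⁻¹) g (trace_nilp (u none))
        (det_nilp _) (nilp_ne_zero _), (chartMap_eq g G hH).symm⟩
    · rw [hFu]
      exact ((Matrix.isUnit_iff_isUnit_det _).1 H⁻¹.isUnit).ne_zero
    · change chartCoords (F (φ u))⁻¹ (slope p c (pullback G (φ u))) = u
      rw [hFu, hpull, slope_blockConj H⁻¹ (hpB _) (hB _).red_last (hnB _) he0,
        ← Matrix.coe_units_inv, inv_inv, hH, chartCoords_chartMatrix]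
  · rintro _ ⟨M', hM', rfl⟩ ⟨⟨-, hy⟩, hdet⟩
    obtain ⟨G', n, ht, hd, hn, h01, hG'⟩ | ⟨G', t, hG'⟩ :=
      exists_eq_basedFamily_nilp hdistinct h hM' g
    · replace hG' : M' = blockConj G' (basedFamily lam c g n) := funext hG'
      -- Points of the stratum with n₀₁ = 0 lie outside O.
      refine absurd ?_ hy
      change epsEntry p c (pullback G (coords M')) = 0
      rw [hG', pullback_coords_blockConj]
      exact epsEntry_blockConj_eq_zero _ (hp n ht hd hn)
        (isDualQuadruple_basedFamily h g ht hd hn).red_last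
        (by rw [infPart_basedFamily, h01])
    · replace hG' : M' = blockConj G' (B t) := funext hG'
      have hpull : pullback G (coords M') = blockConj (G⁻¹ * G') (B t) := by
        rw [hG', pullback_coords_blockConj]
      have he0 : epsEntry p c (blockConj (G⁻¹ * G') (B t)) ≠ 0 := by
        rw [← hpull]
        exact hy
      have hFy : F (coords M') = frame S p c (blockConj (G⁻¹ * G') (B t)) := by
        rw [← hpull]
      obtain ⟨hconj, k0, k1⟩ := eq_frame_conj (G⁻¹ * G') (hpB t) (hB t).red_last (hnB t) he0 hFy
        hdet
      have hslope : slope p c (pullback G (coords M')) = t := by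
        rw [hpull, slope_blockConj _ (hpB t) (hB t).red_last (hnB t) he0]
      have hψ : ψ (coords M') = chartCoords (F (coords M'))⁻¹ t := by
        rw [← hslope]
      have hmat : chartMatrix (ψ (coords M')) = (F (coords M'))⁻¹ := by
        rw [hψ, chartMatrix_chartCoords k0 k1]
      have hnone : ψ (coords M') none = t := by
        rw [hψ]
        rfl
      have hφψ : φ (ψ (coords M')) = coords M' := by
        change coords _ = _
        congr 1
        funext j
        have hinv : ((F (coords M'))⁻¹)⁻¹ = F (coords M') :=
          Matrix.nonsing_inv_nonsing_inv _ (isUnit_iff_ne_zero.2 hdet)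
        rw [hmat, hnone, hinv, ← hconj j, ← hpull, pullback_coords]
        simp [mul_assoc]
      refine ⟨⟨⟨trivial, ?_⟩, ?_⟩, hφψ⟩
      · rw [hmat, Matrix.det_nonsing_inv, Ring.inverse_eq_inv']
        exact inv_ne_zero hdet
      · rw [hφψ]
        exact hy

end Charts

/-! ### Irreducibility -/

section Irreducibility

variable {lam : Fin 3 → Fin 2 → ℂ} {c : ℂ}

/-- The entries of a pair of matrices of sizes four and two. -/
abbrev PairIndex : Type := (Fin 2 ⊕ Fin 2) × (Fin 2 ⊕ Fin 2) ⊕ Fin 2 × Fin 2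

/-- The first matrix of a pair. -/
def pairFst (u : PairIndex → ℂ) : Mat4 := Matrix.of fun i j => u (Sum.inl (i, j))

/-- The second matrix of a pair. -/
def pairSnd (u : PairIndex → ℂ) : Mat2 := Matrix.of fun i j => u (Sum.inr (i, j))

theorem regMatAt_pairFst (u : PairIndex → ℂ) : RegMatAt pairFst u := fun _ _ => RegAt.coord _ u

theorem regMatAt_pairSnd (u : PairIndex → ℂ) : RegMatAt pairSnd u := fun _ _ => RegAt.coord _ u

/-- The pairs (G, g) of invertible matrices form a non-empty open subset of affine space, and g e₁₂
g⁻¹ runs through all non-zero nilpotent matrices, so the stratum is the image of an irreducible set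
under a regular map. -/
theorem isIrreducible_coords_stratumW (hdistinct : ∀ j, lam j 0 ≠ lam j 1)
    (h : IsRelativelyGenericNotGeneric lam c) :
    IsIrreducible (coords '' stratumW lam c : Set (Aff EntryIndex)) := by
  let n : (PairIndex → ℂ) → Mat2 := fun u => pairSnd u * nilp 0 * (pairSnd u)⁻¹
  let Φ : Aff PairIndex → Aff EntryIndex := fun u => coords fun j =>
    pairFst u * blockHom (normalFamily lam c (n u) j) * (pairFst u)⁻¹
  let U₁ : Set (Aff PairIndex) := {u | u ∈ (Set.univ : Set (Aff PairIndex)) ∧ (pairFst u).det ≠ 0}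
  let U : Set (Aff PairIndex) := {u | u ∈ U₁ ∧ (pairSnd u).det ≠ 0}
  have hU : IsOpen U := isOpen_setOf_ne_zero
    (isOpen_setOf_ne_zero isOpen_univ fun u _ => (regMatAt_pairFst u).det)
    fun u _ => (regMatAt_pairSnd u).det
  have hne : U.Nonempty := by
    refine ⟨Sum.elim (fun q => (1 : Mat4) q.1 q.2) (fun q => (1 : Mat2) q.1 q.2),
      ⟨trivial, ?_⟩, ?_⟩
    · change (1 : Mat4).det ≠ 0
      simp
    · change (1 : Mat2).det ≠ 0
      simp
  have hΦ : ∀ u ∈ U, ∀ k, RegAt (fun u => Φ u k) u := by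
    rintro u ⟨⟨-, h1⟩, h2⟩ k
    have hn : RegMatAt n u := ((regMatAt_pairSnd u).mul (RegMatAt.const _ u)).mul
      ((regMatAt_pairSnd u).inv h2)
    exact ((regMatAt_pairFst u).mul (RegMatAt.normalFamily hn k.1).blockHom).mul
      ((regMatAt_pairFst u).inv h1) k.2.1 k.2.2
  have himage : (coords '' stratumW lam c : Set (Aff EntryIndex)) = Φ '' U := by
    ext x
    constructor
    · rintro ⟨M, hM, rfl⟩
      obtain ⟨G, m, ht, hd, hm, hG⟩ := exists_eq_blockHom_normalFamily hdistinct h hM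
      obtain ⟨g, hg⟩ := exists_eq_conj_single ht hd hm
      refine ⟨Sum.elim (fun q => (G : Mat4) q.1 q.2) (fun q => (g : Mat2) q.1 q.2),
        ⟨⟨trivial, ?_⟩, ?_⟩, ?_⟩
      · exact ((Matrix.isUnit_iff_isUnit_det _).1 G.isUnit).ne_zero
      · exact ((Matrix.isUnit_iff_isUnit_det _).1 g.isUnit).ne_zero
      · have hn0 : Matrix.single 0 1 1 = nilp 0 := by
          ext i j
          fin_cases i <;> fin_cases j <;> simp [nilp]
        change coords (fun j => (G : Mat4) *
          blockHom (normalFamily lam c ((g : Mat2) * nilp 0 * (g : Mat2)⁻¹) j) * (G : Mat4)⁻¹) = _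
        congr 1
        funext j
        rw [hG j, hg, hn0, Matrix.coe_units_inv, Matrix.coe_units_inv]
    · rintro ⟨u, ⟨⟨-, h1⟩, h2⟩, rfl⟩
      obtain ⟨G, hG⟩ := exists_units_eq h1
      obtain ⟨g, hg⟩ := (Matrix.isUnit_iff_isUnit_det (pairSnd u)).2 (isUnit_iff_ne_zero.2 h2)
      obtain ⟨k1, k2, k3⟩ := nilpotent_conj (trace_nilp 0) (det_nilp 0) (nilp_ne_zero 0) g
      refine ⟨_, (mem_stratumW_iff hdistinct h).2
        ⟨_, isDualQuadruple_normalFamily h k1 k2 k3, G, fun _ => rfl⟩, ?_⟩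
      change coords _ = coords _
      congr 1
      funext j
      rw [Matrix.coe_units_inv, Matrix.coe_units_inv, hG, hg]
  rw [himage]
  exact (isIrreducible_of_isOpen hU hne).image _ (continuousOn_of_regAt hU hΦ)

end Irreducibility

end DeligneSimpson

theorem mainTheorem7 (lam : Fin 3 → Fin 2 → ℂ) (c : ℂ)
    (hdistinct : ∀ j, lam j 0 ≠ lam j 1)
    (hgeneric : DeligneSimpson.IsRelativelyGenericNotGeneric lam c) :
    DeligneSimpson.IsIrreducibleSmoothVariety
      (DeligneSimpson.coords '' DeligneSimpson.stratumW lam c) 15 := by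
  rw [← DeligneSimpson.card_chartIndex]
  exact DeligneSimpson.isIrreducibleSmoothVariety_of_charts
    (DeligneSimpson.isIrreducible_coords_stratumW hdistinct hgeneric)
    fun _ hx => DeligneSimpson.exists_chart hdistinct hgeneric hx
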